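/- **Adequacy lemma for the typed $\lambda$-calculus with constructors without case composition.** *Terms.* Fix a set of constructors $\mathtt c,\mathtt d,\dots$. Terms are $t,u ::= x \mid \lambda x.t \mid tu \mid \mathtt c \mid \{|\theta|\}\cdot t \mid ✠$ (daimon), where a case binding $\theta=\{\mathtt c_1\mapsto u_1;\dots;\mathtt c_n\mapsto u_n\}$ ($n\ge 0$) is a finite function from constructors to terms; terms are taken up to $\alpha$-conversion. The relation $\to$ is the contextual closure of $(\lambda x.t)u\to t\{x\leftarrow u\}$; $✠u\to ✠$; $\lambda x.tx\to t$ ($x\notin FV(t)$); $\lambda x.✠\to ✠$; $\{|\theta|\}\cdot \mathtt c\to t$ if $(\mathtt c\mapsto t)\in\theta$; $\{|\theta|\}\cdot ✠\to ✠$; and the two commutation rules $\{|\theta|\}\cdot(tu)\to(\{|\theta|\}\cdot t)u$ and $\{|\theta|\}\cdot\lambda x.t\to\lambda x.\{|\theta|\}\cdot t$ ($x\notin FV(\theta)$). The contextual closure of the last two is written $\to_{com}$. A *data structure* is a term $\mathtt c\,t_1\dots t_k$ ($k\ge0$); a *value* is a data structure or an abstraction. A term is *defined* if it has no subterm $\{|\theta|\}\cdot\mathtt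 c$ with $\mathtt c\notin\mathrm{dom}(\theta)$; it is *perfectly normalising* if it has no infinite reduction and all its reducts (in any number of steps) are defined. A term is *neutral* if it is closed, defined and not a value. *Candidates.* A set $S$ of closed terms is a *reducibility candidate* if (CR1) its elements are perfectly normalising; (CR2) $t\in S$ and $t\to t'$ imply $t'\in S$; (CR3) if $t$ is neutral and all its one-step reducts are in $S$, then $t\in S$; (CR4) $t\to_{com}t'$ and $t'\in S$ imply $t\in S$. It is a *data candidate* if moreover all its values are data structures. For a set $X$ of closed terms, $\overline X$ is the least set that contains $X$ and is closed under CR3. *Types.* There are ordinary type variables $X$ and data type variables $\alpha$; $\nu$ stands for either. Types and data types are $$T,U ::= X\mid \alpha\mid \mathbf c\mid DT\mid T\to U\mid T\cup U\mid T\cap U\mid \forall\nu.T\mid\exists\nu.T,$$ $$D,E ::= \alpha\mid\mathbf c\mid DT\mid D\cup E\mid D\cap E\mid\forall\nu.D\mid\exists\nu.D.$$ For $\vec T=T_1;\dots;T_k$ ($k\ge0$), $\mathbf c\vec T=\mathbf cT_1\dots T_k$ and $\vec T\to U=T_1\to\dots\to T_k\to U$; $TV$ denotes free type variables. *Subtyping*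 $\le$ is the least reflexive and transitive relation on types such that (all index families being finite and non-empty, $D,D',D_i$ being data types, and $A$ being a type if $\nu$ is an ordinary variable and a data type if $\nu$ is a data variable): - $T\to U\le T'\to U'$ if $T'\le T$ and $U\le U'$; $DT\le D'T'$ if $D\le D'$ and $T\le T'$; - $U_i\le U_1\cup U_2$; $T_1\cup T_2\le U$ if $T_1\le U$ and $T_2\le U$; $U_1\cap U_2\le U_i$; $T\le U_1\cap U_2$ if $T\le U_1$ and $T\le U_2$; - $T\le\forall\nu.U$ if $T\le U$ and $\nu\notin TV(T)$; $\forall\nu.T\le T\{\nu\leftarrow A\}$; $T\{\nu\leftarrow A\}\le\exists\nu.T$; $\exists\nu.U\le T$ if $U\le T$ and $\nu\notin TV(T)$; - $D\le T\to DT$; $\mathbf c_1\vec T\cap\mathbf c_2\vec U\le\forall\alpha.\alpha$ if $\mathtt c_1\ne\mathtt c_2$; - $\bigcap_iD_iT_i\le(\bigcap_iD_i)(\bigcap_iT_i)$; $\forall\nu.(DT)\le(\forall\nu.D)(\forall\nu.T)$; - $\bigcap_i(T_i\to U_i)\le(\bigcap_iT_i)\to(\bigcap_iU_i)$; $\forall\nu.(T\to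 U)\le(\forall\nu.T)\to(\forall\nu.U)$; - $\bigcap_i(T_i\to U_i)\le(\bigcup_iT_i)\to(\bigcup_iU_i)$; $\forall\nu.(T\to U)\le(\exists\nu.T)\to(\exists\nu.U)$; - $D(\bigcup_iT_i)\le\bigcup_iDT_i$; $(\bigcup_iD_i)T\le\bigcup_iD_iT$; $D(\exists\nu.T)\le\exists\nu.DT$ if $\nu\notin TV(D)$; $(\exists\nu.D)T\le\exists\nu.DT$ if $\nu\notin TV(T)$; - $\forall\nu.(T\cup U)\le(\forall\nu.T)\cup U$ and $(\exists\nu.T)\cap U\le\exists\nu.(T\cap U)$ if $\nu\notin TV(U)$. *Typing.* A context $\Gamma$ is a finite list of declarations $x:T$ for distinct variables. The judgements $\Gamma\vdash M:T$, where $M$ is a term or a case binding, are defined inductively by: - (Cb) if $\theta=\{\mathtt c_i\mapsto u_i\mid 1\le i\le n\}$ and $\Gamma\vdash u_i:\vec U_i\to T_i$ for all $i$, then $\Gamma\vdash\theta:\mathbf c_{i_0}\vec U_{i_0}\to T_{i_0}$ for each $1\le i_0\le n$; (Cb$_\bot$) if $\Gamma\vdash u_i:T_i$ for all $i$, then $\Gamma\vdash\theta:(\forall\alpha.\alpha)\to(\forall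 X.X)$ ($n\ge0$); - $\Gamma\vdash x:T$ if $(x:T)\in\Gamma$; $\Gamma\vdash ✠:T$; $\Gamma\vdash\mathtt c:\mathbf c$; - $\Gamma\vdash\lambda x.t:T\to U$ if $\Gamma,x:T\vdash t:U$; $\Gamma\vdash tu:U$ if $\Gamma\vdash t:T\to U$ and $\Gamma\vdash u:T$; - (case) $\Gamma\vdash\{|\theta|\}\cdot t:\vec U\to T'$ if $\Gamma\vdash t:\vec U\to T$ and $\Gamma\vdash\theta:T\to T'$; - $\Gamma\vdash M:\forall\nu.T$ if $\Gamma\vdash M:T$ and $\nu\notin TV(\Gamma)$; $\Gamma\vdash M:T\cap U$ if $\Gamma\vdash M:T$ and $\Gamma\vdash M:U$; - (Exist) $\Gamma,x:\exists\nu.T\vdash M:U$ if $\Gamma,x:T\vdash M:U$ and $\nu\notin TV(\Gamma)\cup TV(U)$; - $\Gamma,x:T_1\cup T_2\vdash M:U$ if $\Gamma,x:T_1\vdash M:U$ and $\Gamma,x:T_2\vdash M:U$; - $\Gamma\vdash M:U$ if $\Gamma\vdash M:T$ and $T\le U$. *Interpretation.* A valuation $\rho$ maps ordinary type variables to reducibility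 candidates and data type variables to data candidates. Put $[\![\nu]\!]_\rho=\rho(\nu)$; $[\![\mathbf c]\!]_\rho=\overline{\{\mathtt c\}}$; $[\![DT]\!]_\rho=\overline{\{tu\mid t\in[\![D]\!]_\rho,\,u\in[\![T]\!]_\rho\}}$; $[\![T\to U]\!]_\rho=\{t\text{ closed}\mid\forall u\in[\![T]\!]_\rho,\ tu\in[\![U]\!]_\rho\}$; $\cup,\cap$ are interpreted by union and intersection, and $[\![\forall\nu.T]\!]_\rho$ (resp. $[\![\exists\nu.T]\!]_\rho$) is the intersection (resp. union) of the sets $[\![T]\!]_{\rho,\nu\mapsto\mathcal A}$ over all reducibility candidates $\mathcal A$ if $\nu$ is an ordinary variable and over all data candidates $\mathcal A$ if $\nu$ is a data variable. The interpretation of $T$ as a type for case bindings is $[\![T]\!]^{cb}_\rho=\{\theta\mid\lambda x.\{|\theta|\}\cdot x\in[\![T]\!]_\rho\}$ ($x\notin FV(\theta)$). A substitution $\sigma$ satisfies $\Gamma$ for $\rho$ if $\sigma(x)\in[\![T]\!]_\rho$ for every $(x:T)\in\Gamma$. **Proposition.** Let $\Gamma$ be a context and $T$ a type. 1. If $t$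 is a term with $\Gamma\vdash t:T$, then $t_\sigma\in[\![T]\!]_\rho$ for every valuation $\rho$ and every substitution $\sigma$ that satisfies $\Gamma$ for $\rho$. 2. If $\theta$ is a case binding with $\Gamma\vdash\theta:T$, then $\theta_\sigma\in[\![T]\!]^{cb}_\rho$ for every valuation $\rho$ and every substitution $\sigma$ that satisfies $\Gamma$ for $\rho$. -/

import Mathlib

/-! The lambda calculus with constructors (without case composition), its second-order type system
with union and intersection types, and its model by reducibility candidates.

Terms and types are taken up to renaming of bound variables, by de Bruijn indices.  `C` is the set
of constructors. -/

namespace LamCon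

universe u

section Terms

variable {C : Type u}

/-- Terms.  In `case dom θ t`, the pair `(dom, θ)` is a case binding: a finite partial function from
constructors to terms, with domain `dom`. -/
inductive Tm (C : Type u) : Type u
  | var (i : ℕ) : Tm C
  | lam (t : Tm C) : Tm C
  | app (t u : Tm C) : Tm C
  | con (c : C) : Tm C
  | case (dom : Finset C) (θ : {c // c ∈ dom} → Tm C) (t : Tm C) : Tm C
  | dai : Tm C

/-- Case bindings. -/
structure CaseBinding (C : Type u) : Type u where
  dom : Finset C
  branch : {c // c ∈ dom} → Tm C

/-- Lifting of a renaming under one binder. -/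
def upRen (ξ : ℕ → ℕ) : ℕ → ℕ
  | 0 => 0
  | i + 1 => ξ i + 1

def Tm.rename (ξ : ℕ → ℕ) : Tm C → Tm C
  | .var i => .var (ξ i)
  | .lam t => .lam (t.rename (upRen ξ))
  | .app t u => .app (t.rename ξ) (u.rename ξ)
  | .con c => .con c
  | .case dom θ t => .case dom (fun c => (θ c).rename ξ) (t.rename ξ)
  | .dai => .dai

/-- Weakening: the same term, in a scope with one more variable (of index `0`). -/
def Tm.shift (t : Tm C) : Tm C := t.rename Nat.succ

/-- Lifting of a substitution under one binder. -/
def upSub (σ : ℕ → Tm C) : ℕ → Tm C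
  | 0 => .var 0
  | i + 1 => (σ i).shift

/-- Capture-avoiding simultaneous substitution `t_σ`. -/
def Tm.subst (σ : ℕ → Tm C) : Tm C → Tm C
  | .var i => σ i
  | .lam t => .lam (t.subst (upSub σ))
  | .app t u => .app (t.subst σ) (u.subst σ)
  | .con c => .con c
  | .case dom θ t => .case dom (fun c => (θ c).subst σ) (t.subst σ)
  | .dai => .dai

/-- `t.inst u` is `t{x ← u}` for `x` the variable of index `0`. -/
def Tm.inst (t u : Tm C) : Tm C :=
  t.subst fun i => match i with
    | 0 => u
    | j + 1 => .var j

namespace CaseBinding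

/-- The case construct `{|θ|}·t`. -/
def on (θ : CaseBinding C) (t : Tm C) : Tm C := .case θ.dom θ.branch t

def shift (θ : CaseBinding C) : CaseBinding C := ⟨θ.dom, fun c => (θ.branch c).shift⟩

def subst (σ : ℕ → Tm C) (θ : CaseBinding C) : CaseBinding C :=
  ⟨θ.dom, fun c => (θ.branch c).subst σ⟩

end CaseBinding

/-- All free variables have index `< n`. -/
def Tm.ClosedAt : ℕ → Tm C → Prop
  | n, .var i => i < n
  | n, .lam t => t.ClosedAt (n + 1)
  | n, .app t u => t.ClosedAt n ∧ u.ClosedAt n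
  | _, .con _ => True
  | n, .case _ θ t => (∀ c, (θ c).ClosedAt n) ∧ t.ClosedAt n
  | _, .dai => True

def Tm.Closed (t : Tm C) : Prop := t.ClosedAt 0

/-! ### Reduction -/

/-- The rules other than case commutation, at the root of a term:
AppLam, AppDai, LamApp, LamDai, CaseCons, CaseDai. -/
inductive RootB : Tm C → Tm C → Prop
  | appLam (t u : Tm C) : RootB (.app (.lam t) u) (t.inst u)
  | appDai (u : Tm C) : RootB (.app .dai u) .dai
  | lamApp (t : Tm C) : RootB (.lam (.app t.shift (.var 0))) t
  | lamDai : RootB (.lam .dai) .dai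
  | caseCons (θ : CaseBinding C) (c : {c // c ∈ θ.dom}) : RootB (θ.on (.con c)) (θ.branch c)
  | caseDai (θ : CaseBinding C) : RootB (θ.on .dai) .dai

/-- The case commutation rules, at the root of a term: CaseApp, CaseLam. -/
inductive RootCom : Tm C → Tm C → Prop
  | caseApp (θ : CaseBinding C) (t u : Tm C) : RootCom (θ.on (.app t u)) (.app (θ.on t) u)
  | caseLam (θ : CaseBinding C) (t : Tm C) : RootCom (θ.on (.lam t)) (.lam (θ.shift.on t))

/-- Contextual closure of a relation on terms: one step at one position. -/
inductive Compat (R : Tm C → Tm C → Prop) : Tm C → Tm C → Prop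
  | root {t t' : Tm C} : R t t' → Compat R t t'
  | lam {t t' : Tm C} : Compat R t t' → Compat R (.lam t) (.lam t')
  | appL {t t' : Tm C} (u : Tm C) : Compat R t t' → Compat R (.app t u) (.app t' u)
  | appR (t : Tm C) {u u' : Tm C} : Compat R u u' → Compat R (.app t u) (.app t u')
  | caseArg (dom : Finset C) (θ : {c // c ∈ dom} → Tm C) {t t' : Tm C} :
      Compat R t t' → Compat R (.case dom θ t) (.case dom θ t')
  | caseBranch (dom : Finset C) (θ θ' : {c // c ∈ dom} → Tm C) (t : Tm C) (c : {c // c ∈ dom}) :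
      Compat R (θ c) (θ' c) → (∀ d, d ≠ c → θ' d = θ d) →
      Compat R (.case dom θ t) (.case dom θ' t)

/-- One-step reduction with all rules except CaseCase. -/
def Step : Tm C → Tm C → Prop := Compat fun t t' => RootB t t' ∨ RootCom t t'

/-- One step of case commutation. -/
def ComStep : Tm C → Tm C → Prop := Compat RootCom

/-! ### Values, defined terms, perfect normalisation -/

/-- `c t₁ … tₖ`, with `k ≥ 0`. -/
inductive IsDataStructure : Tm C → Prop
  | con (c : C) : IsDataStructure (.con c)
  | app {t : Tm C} (u : Tm C) : IsDataStructure t → IsDataStructure (.app t u)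

def IsValue (t : Tm C) : Prop := IsDataStructure t ∨ ∃ t₀, t = .lam t₀

/-- No subterm is a match failure `{|θ|}·c` with `c ∉ dom θ`. -/
def Tm.Defined : Tm C → Prop
  | .var _ => True
  | .lam t => t.Defined
  | .app t u => t.Defined ∧ u.Defined
  | .con _ => True
  | .case dom θ t => (∀ c, (θ c).Defined) ∧ t.Defined ∧ ∀ c, t = .con c → c ∈ dom
  | .dai => True

def HereditarilyDefined (t : Tm C) : Prop := ∀ u, Relation.ReflTransGen Step t u → u.Defined

/-- No infinite reduction starts from `t`. -/
def StronglyNormalising (t : Tm C) : Prop := Acc (fun u t => Step t u) t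

def PerfectlyNormalising (t : Tm C) : Prop := StronglyNormalising t ∧ HereditarilyDefined t

/-- Defined closed terms that are not values. -/
def IsNeutral (t : Tm C) : Prop := t.Closed ∧ t.Defined ∧ ¬ IsValue t

/-! ### Reducibility candidates -/

structure IsCandidate (S : Set (Tm C)) : Prop where
  closed : ∀ t ∈ S, t.Closed
  cr1 : ∀ t ∈ S, PerfectlyNormalising t
  cr2 : ∀ t ∈ S, ∀ t', Step t t' → t' ∈ S
  cr3 : ∀ t, IsNeutral t → (∀ t', Step t t' → t' ∈ S) → t ∈ S
  cr4 : ∀ t t', ComStep t t' → t' ∈ S → t ∈ S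

/-- A candidate all of whose values are data structures. -/
structure IsDataCandidate (S : Set (Tm C)) : Prop extends IsCandidate S where
  values : ∀ t ∈ S, IsValue t → IsDataStructure t

/-- Closure of a set of closed terms by neutral expansion. -/
inductive Clo (X : Set (Tm C)) : Tm C → Prop
  | base {t : Tm C} : t ∈ X → Clo X t
  | neutral {t : Tm C} : IsNeutral t → (∀ t', Step t t' → Clo X t') → Clo X t

def clo (X : Set (Tm C)) : Set (Tm C) := {t | Clo X t}

def setArrow (A B : Set (Tm C)) : Set (Tm C) := {t | t.Closed ∧ ∀ u ∈ A, Tm.app t u ∈ B}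

def setApp (A B : Set (Tm C)) : Set (Tm C) := {s | ∃ t ∈ A, ∃ u ∈ B, s = Tm.app t u}

end Terms

section Types

variable {C : Type u}

/-- The two kinds of types and of type variables: ordinary ones and data ones. -/
inductive Kind : Type
  | ord : Kind
  | data : Kind
  deriving DecidableEq

/-- `Ty C .ord` is the set of types, `Ty C .data` the set of data types (which is a syntactic
sub-class of the former, through `Ty.toOrd`).  Ordinary type variables and data type variables have
separate de Bruijn indices; `all s` and `ex s` bind the variable of kind `s` and index `0`. -/
inductive Ty (C : Type u) : Kind → Type u
  | tvar (i : ℕ) : Ty C .ord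
  | dvar {k : Kind} (i : ℕ) : Ty C k
  | con {k : Kind} (c : C) : Ty C k
  | app {k : Kind} (D : Ty C .data) (T : Ty C .ord) : Ty C k
  | arrow (T U : Ty C .ord) : Ty C .ord
  | union {k : Kind} (T U : Ty C k) : Ty C k
  | inter {k : Kind} (T U : Ty C k) : Ty C k
  | all {k : Kind} (s : Kind) (T : Ty C k) : Ty C k
  | ex {k : Kind} (s : Kind) (T : Ty C k) : Ty C k

namespace Ty

/-- A data type, seen as a type (and the identity on types). -/
def toOrd : {k : Kind} → Ty C k → Ty C .ord
  | _, tvar i => tvar i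
  | _, dvar i => dvar i
  | _, con c => con c
  | _, app D T => app D T
  | _, arrow T U => arrow T U
  | _, union T U => union T.toOrd U.toOrd
  | _, inter T U => inter T.toOrd U.toOrd
  | _, all s T => all s T.toOrd
  | _, ex s T => ex s T.toOrd

/-- A data type, seen as a type of kind `k`. -/
def ofData : (k : Kind) → Ty C .data → Ty C k
  | .ord, D => D.toOrd
  | .data, D => D

/-- The type variable of kind `s` and index `i`. -/
def varOf : (s : Kind) → ℕ → Ty C s
  | .ord, i => tvar i
  | .data, i => dvar i

/-- Lifting of a renaming under a binder of kind `s`. -/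
def upRen (s : Kind) (ξ : Kind → ℕ → ℕ) : Kind → ℕ → ℕ := fun s' i =>
  if s' = s then
    match i with
    | 0 => 0
    | j + 1 => ξ s' j + 1
  else ξ s' i

def rename : {k : Kind} → (Kind → ℕ → ℕ) → Ty C k → Ty C k
  | _, ξ, tvar i => tvar (ξ .ord i)
  | _, ξ, dvar i => dvar (ξ .data i)
  | _, _, con c => con c
  | _, ξ, app D T => app (D.rename ξ) (T.rename ξ)
  | _, ξ, arrow T U => arrow (T.rename ξ) (U.rename ξ)
  | _, ξ, union T U => union (T.rename ξ) (U.rename ξ)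
  | _, ξ, inter T U => inter (T.rename ξ) (U.rename ξ)
  | _, ξ, all s T => all s (T.rename (upRen s ξ))
  | _, ξ, ex s T => ex s (T.rename (upRen s ξ))

/-- Weakening: the same type, in a scope with one more type variable of kind `s` (of index `0`).
The types of the form `T.shift s` are those in which that variable does not occur free. -/
def shift {k : Kind} (s : Kind) (T : Ty C k) : Ty C k :=
  T.rename fun s' i => if s' = s then i + 1 else i

/-- Lifting of a substitution under a binder of kind `s`. -/
def upSub (s : Kind) (τ : (s : Kind) → ℕ → Ty C s) : (s : Kind) → ℕ → Ty C s := fun s' i =>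
  if s' = s then
    match i with
    | 0 => varOf s' 0
    | j + 1 => (τ s' j).shift s
  else (τ s' i).shift s

/-- Capture-avoiding simultaneous substitution of types for ordinary type variables and of data
types for data type variables. -/
def subst : {k : Kind} → ((s : Kind) → ℕ → Ty C s) → Ty C k → Ty C k
  | _, τ, tvar i => τ .ord i
  | k, τ, dvar i => ofData k (τ .data i)
  | _, _, con c => con c
  | _, τ, app D T => app (D.subst τ) (T.subst τ)
  | _, τ, arrow T U => arrow (T.subst τ) (U.subst τ)
  | _, τ, union T U => union (T.subst τ) (U.subst τ)
  | _, τ, inter T U => inter (T.subst τ) (U.subst τ)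
  | _, τ, all s T => all s (T.subst (upSub s τ))
  | _, τ, ex s T => ex s (T.subst (upSub s τ))

/-- The substitution of `A` for the variable of kind `s` and index `0`. -/
def single : (s : Kind) → Ty C s → (s' : Kind) → ℕ → Ty C s'
  | .ord, A, .ord, 0 => A
  | .ord, _, .ord, j + 1 => tvar j
  | .ord, _, .data, i => dvar i
  | .data, A, .data, 0 => A
  | .data, _, .data, j + 1 => dvar j
  | .data, _, .ord, i => tvar i

/-- `T.inst s A` is `T{ν ← A}` for `ν` the type variable of kind `s` and index `0`. -/
def inst {k : Kind} (s : Kind) (T : Ty C k) (A : Ty C s) : Ty C k := T.subst (single s A)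

/-- The data type `c T₁ … Tₙ`. -/
def conApp (c : C) (Ts : List (Ty C .ord)) : Ty C .data := Ts.foldl (fun D T => app D T) (con c)

/-- The type `T₁ → … → Tₙ → U`. -/
def arrows (Ts : List (Ty C .ord)) (U : Ty C .ord) : Ty C .ord := Ts.foldr arrow U

/-- The intersection `T₀ ∩ … ∩ Tₙ`. -/
def bigInter {k : Kind} : (n : ℕ) → (Fin (n + 1) → Ty C k) → Ty C k
  | 0, T => T 0
  | n + 1, T => inter (bigInter n fun i => T i.castSucc) (T (Fin.last (n + 1)))

/-- The union `T₀ ∪ … ∪ Tₙ`. -/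
def bigUnion {k : Kind} : (n : ℕ) → (Fin (n + 1) → Ty C k) → Ty C k
  | 0, T => T 0
  | n + 1, T => union (bigUnion n fun i => T i.castSucc) (T (Fin.last (n + 1)))

end Ty

open Ty

/-- Sub-typing. -/
inductive Sub : Ty C .ord → Ty C .ord → Prop
  | refl (T : Ty C .ord) : Sub T T
  | trans {T T₀ T' : Ty C .ord} : Sub T T₀ → Sub T₀ T' → Sub T T'
  | arrow {T T' U U' : Ty C .ord} : Sub T' T → Sub U U' → Sub (arrow T U) (arrow T' U')
  | app {D D' : Ty C .data} {T T' : Ty C .ord} :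
      Sub D.toOrd D'.toOrd → Sub T T' → Sub (app D T) (app D' T')
  | unionIntroL (U₁ U₂ : Ty C .ord) : Sub U₁ (union U₁ U₂)
  | unionIntroR (U₁ U₂ : Ty C .ord) : Sub U₂ (union U₁ U₂)
  | unionElim {T₁ T₂ U : Ty C .ord} : Sub T₁ U → Sub T₂ U → Sub (union T₁ T₂) U
  | interIntro {T U₁ U₂ : Ty C .ord} : Sub T U₁ → Sub T U₂ → Sub T (inter U₁ U₂)
  | interElimL (U₁ U₂ : Ty C .ord) : Sub (inter U₁ U₂) U₁
  | interElimR (U₁ U₂ : Ty C .ord) : Sub (inter U₁ U₂) U₂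
  | allIntro (s : Kind) {T U : Ty C .ord} : Sub (T.shift s) U → Sub T (all s U)
  | allElim (s : Kind) (T : Ty C .ord) (A : Ty C s) : Sub (all s T) (T.inst s A)
  | exIntro (s : Kind) (T : Ty C .ord) (A : Ty C s) : Sub (T.inst s A) (ex s T)
  | exElim (s : Kind) {T U : Ty C .ord} : Sub U (T.shift s) → Sub (ex s U) T
  | data (D : Ty C .data) (T : Ty C .ord) : Sub D.toOrd (arrow T (app D T))
  | constr (c₁ c₂ : C) (Ts Us : List (Ty C .ord)) : c₁ ≠ c₂ →
      Sub (inter (conApp c₁ Ts).toOrd (conApp c₂ Us).toOrd) (all .data (dvar 0))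
  | appInter (n : ℕ) (D : Fin (n + 1) → Ty C .data) (T : Fin (n + 1) → Ty C .ord) :
      Sub (bigInter n fun i => app (D i) (T i)) (app (bigInter n D) (bigInter n T))
  | appAll (s : Kind) (D : Ty C .data) (T : Ty C .ord) :
      Sub (all s (app D T)) (app (all s D) (all s T))
  | arrowInter (n : ℕ) (T U : Fin (n + 1) → Ty C .ord) :
      Sub (bigInter n fun i => arrow (T i) (U i)) (arrow (bigInter n T) (bigInter n U))
  | arrowAll (s : Kind) (T U : Ty C .ord) :
      Sub (all s (arrow T U)) (arrow (all s T) (all s U))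
  | arrowUnion (n : ℕ) (T U : Fin (n + 1) → Ty C .ord) :
      Sub (bigInter n fun i => arrow (T i) (U i)) (arrow (bigUnion n T) (bigUnion n U))
  | arrowEx (s : Kind) (T U : Ty C .ord) :
      Sub (all s (arrow T U)) (arrow (ex s T) (ex s U))
  | unionAppR (n : ℕ) (D : Ty C .data) (T : Fin (n + 1) → Ty C .ord) :
      Sub (app D (bigUnion n T)) (bigUnion n fun i => app D (T i))
  | unionAppL (n : ℕ) (D : Fin (n + 1) → Ty C .data) (T : Ty C .ord) :
      Sub (app (bigUnion n D) T) (bigUnion n fun i => app (D i) T)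
  | exAppR (s : Kind) (D : Ty C .data) (T : Ty C .ord) :
      Sub (app D (ex s T)) (ex s (app (D.shift s) T))
  | exAppL (s : Kind) (D : Ty C .data) (T : Ty C .ord) :
      Sub (app (ex s D) T) (ex s (app D (T.shift s)))
  | unionAll (s : Kind) (T U : Ty C .ord) :
      Sub (all s (union T (U.shift s))) (union (all s T) U)
  | exInter (s : Kind) (T U : Ty C .ord) :
      Sub (inter (ex s T) U) (ex s (inter T (U.shift s)))

/-- Typing contexts: the `i`-th entry is the type of the variable of index `i`. -/
abbrev Ctx (C : Type u) : Type u := List (Ty C .ord)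

/-- The subject of a typing judgement: a term or a case binding. -/
inductive Subject (C : Type u) : Type u
  | tm (t : Tm C) : Subject C
  | cb (θ : CaseBinding C) : Subject C

/-- The typing judgement `Γ ⊢ M : T`. -/
inductive Typing : Ctx C → Subject C → Ty C .ord → Prop
  -- case bindings
  | cb {Γ : Ctx C} (θ : CaseBinding C)
      (U : {c // c ∈ θ.dom} → List (Ty C .ord)) (T : {c // c ∈ θ.dom} → Ty C .ord)
      (h : ∀ c, Typing Γ (.tm (θ.branch c)) (arrows (U c) (T c))) (c₀ : {c // c ∈ θ.dom}) :
      Typing Γ (.cb θ) (arrow (conApp c₀.1 (U c₀)).toOrd (T c₀))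
  | cbBot {Γ : Ctx C} (θ : CaseBinding C) (T : {c // c ∈ θ.dom} → Ty C .ord)
      (h : ∀ c, Typing Γ (.tm (θ.branch c)) (T c)) :
      Typing Γ (.cb θ) (arrow (all .data (dvar 0)) (all .ord (tvar 0)))
  -- terms
  | init {Γ : Ctx C} (i : ℕ) {T : Ty C .ord} : Γ[i]? = some T → Typing Γ (.tm (.var i)) T
  | false (Γ : Ctx C) (T : Ty C .ord) : Typing Γ (.tm .dai) T
  | constr (Γ : Ctx C) (c : C) : Typing Γ (.tm (.con c)) (con c)
  | arrowIntro {Γ : Ctx C} {t : Tm C} {T U : Ty C .ord} :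
      Typing (T :: Γ) (.tm t) U → Typing Γ (.tm (.lam t)) (arrow T U)
  | arrowElim {Γ : Ctx C} {t u : Tm C} {T U : Ty C .ord} :
      Typing Γ (.tm t) (arrow T U) → Typing Γ (.tm u) T → Typing Γ (.tm (.app t u)) U
  | case {Γ : Ctx C} {t : Tm C} {θ : CaseBinding C} (U : List (Ty C .ord)) {T T' : Ty C .ord} :
      Typing Γ (.tm t) (arrows U T) → Typing Γ (.cb θ) (arrow T T') →
      Typing Γ (.tm (θ.on t)) (arrows U T')
  -- shared rules
  | univ {Γ : Ctx C} {M : Subject C} (s : Kind) {T : Ty C .ord} :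
      Typing (Γ.map (shift s)) M T → Typing Γ M (all s T)
  | inter {Γ : Ctx C} {M : Subject C} {T U : Ty C .ord} :
      Typing Γ M T → Typing Γ M U → Typing Γ M (inter T U)
  -- the bound type variable of `exist` is free neither in `U` nor in the rest of the context
  | exist {Γ Δ : Ctx C} {M : Subject C} (s : Kind) {T U : Ty C .ord} :
      Typing (Γ.map (shift s) ++ T :: Δ.map (shift s)) M (U.shift s) →
      Typing (Γ ++ ex s T :: Δ) M U
  | union {Γ Δ : Ctx C} {M : Subject C} {T₁ T₂ U : Ty C .ord} :
      Typing (Γ ++ T₁ :: Δ) M U → Typing (Γ ++ T₂ :: Δ) M U →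
      Typing (Γ ++ union T₁ T₂ :: Δ) M U
  | subs {Γ : Ctx C} {M : Subject C} {T U : Ty C .ord} :
      Typing Γ M T → Sub T U → Typing Γ M U

/-! ### Interpretation of types -/

/-- Candidates for a type variable of kind `s`. -/
def IsCandidateOf : Kind → Set (Tm C) → Prop
  | .ord, A => IsCandidate A
  | .data, A => IsDataCandidate A

/-- Valuations map ordinary type variables to candidates and data type variables to data
candidates. -/
def IsValuation (ρ : Kind → ℕ → Set (Tm C)) : Prop := ∀ s i, IsCandidateOf s (ρ s i)

/-- `ρ, ν ↦ A`, for `ν` a new type variable of kind `s` and index `0`. -/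
def extend (s : Kind) (A : Set (Tm C)) (ρ : Kind → ℕ → Set (Tm C)) : Kind → ℕ → Set (Tm C) :=
  fun s' i =>
    if s' = s then
      match i with
      | 0 => A
      | j + 1 => ρ s' j
    else ρ s' i

/-- The interpretation `⟦T⟧_ρ`. -/
def interp : {k : Kind} → Ty C k → (Kind → ℕ → Set (Tm C)) → Set (Tm C)
  | _, .tvar i, ρ => ρ .ord i
  | _, .dvar i, ρ => ρ .data i
  | _, .con c, _ => clo {Tm.con c}
  | _, .app D T, ρ => clo (setApp (interp D ρ) (interp T ρ))
  | _, .arrow T U, ρ => setArrow (interp T ρ) (interp U ρ)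
  | _, .union T U, ρ => interp T ρ ∪ interp U ρ
  | _, .inter T U, ρ => interp T ρ ∩ interp U ρ
  | _, .all s T, ρ => {t | ∀ A, IsCandidateOf s A → t ∈ interp T (extend s A ρ)}
  | _, .ex s T, ρ => {t | ∃ A, IsCandidateOf s A ∧ t ∈ interp T (extend s A ρ)}

/-- The interpretation of `T` as a type for case bindings: the `θ` with `λx. {|θ|}·x ∈ ⟦T⟧_ρ`. -/
def interpCB (T : Ty C .ord) (ρ : Kind → ℕ → Set (Tm C)) : Set (CaseBinding C) :=
  {θ | Tm.lam (θ.shift.on (.var 0)) ∈ interp T ρ}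

/-- The substitution `σ` satisfies the context `Γ` for the valuation `ρ`. -/
def Satisfies (σ : ℕ → Tm C) (Γ : Ctx C) (ρ : Kind → ℕ → Set (Tm C)) : Prop :=
  ∀ i T, Γ[i]? = some T → σ i ∈ interp T ρ

end Types

end LamCon

namespace LamCon

universe u

variable {C : Type u}

open Relation (ReflTransGen TransGen ReflGen)

/-! ### Substitution calculus -/

/-! This is a reducibility argument. Every type is interpreted by a reducibility candidate
(`isCandidateOf_interp`), subtyping is sound for inclusion (`Sub.sound`), and typing is sound by
induction on derivations (`Typing.sound`). A case binding is treated as the term `λx.{|θ|}·x`, so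
one induction proves both statements.

The difficulty lies in showing that the interpretations are candidates, at two points.

The first is CR4, which requires perfect normalisation to be stable under expansion by commutations
(`Good.of_push`). The rules are split into evaluation, commutation and erasure. Commutation is
confluent, decreases `Tm.weight`, and commutes with evaluation in such a way that every evaluation
step is preserved (`Push.star_eval`). Hence perfect normalisation for evaluation and commutation
together is stable under commutation expansion. Erasing steps do not fit into that diagram:
`{|θ|}·(✠u)` erases to `{|θ|}·✠`, which cannot be commuted any further. They are added afterwards:
they shrink terms and can be postponed after computation (`Erase.postpone`, `Good.erase_star`).

The second is CR3 for unions, whose hypothesis only places each reduct in some member of the family.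
A neutral term other than `✠` has a head reduct, and this reduct alone decides membership in a
candidate (`Head.diamond`, `exists_principal`), so a single member can be chosen. Set-theoretic
unions then interpret `∪` and `∃`, which makes the elimination rules for both immediate. Head
reduction also gives CR4 for closures under neutral expansion (`isDataCandidate_clo`), that is, for
`𝐜` and `DT`.

The typing rules for case constructs are handled by moving a case inside an application. CR4 reduces
membership of `{|θ|}·(tu)` to that of `({|θ|}·t)u`, and for neutral terms the target candidate is
replaced by the candidate of terms that fall in it once applied to `u` (`spine`,
`case_neutral_mem`). -/

theorem upRen_comp (ξ ζ : ℕ → ℕ) : upRen (ζ ∘ ξ) = upRen ζ ∘ upRen ξ := by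
  funext i; cases i <;> rfl

/-- The substitution of `u` for the variable of index `0` that acts as `σ` on the others. -/
def scons (u : Tm C) (σ : ℕ → Tm C) : ℕ → Tm C
  | 0 => u
  | i + 1 => σ i

theorem upSub_var : upSub (Tm.var : ℕ → Tm C) = Tm.var := by
  funext i; cases i <;> rfl

namespace Tm

theorem rename_rename (t : Tm C) (ξ ζ : ℕ → ℕ) :
    (t.rename ξ).rename ζ = t.rename (ζ ∘ ξ) := by
  induction t generalizing ξ ζ with
  | var i => rfl
  | lam t ih => simp [rename, ih, upRen_comp]
  | app t u iht ihu => simp [rename, iht, ihu]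
  | con c => rfl
  | case dom θ t ihθ iht => simp [rename, ihθ, iht]
  | dai => rfl

theorem rename_subst (t : Tm C) (ξ : ℕ → ℕ) (σ : ℕ → Tm C) :
    (t.rename ξ).subst σ = t.subst (σ ∘ ξ) := by
  induction t generalizing ξ σ with
  | var i => rfl
  | lam t ih =>
    have h : upSub σ ∘ LamCon.upRen ξ = upSub (σ ∘ ξ) := by funext i; cases i <;> rfl
    simp [rename, subst, ih, h]
  | app t u iht ihu => simp [rename, subst, iht, ihu]
  | con c => rfl
  | case dom θ t ihθ iht => simp [rename, subst, ihθ, iht]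
  | dai => rfl

theorem subst_rename (t : Tm C) (σ : ℕ → Tm C) (ξ : ℕ → ℕ) :
    (t.subst σ).rename ξ = t.subst (fun i => (σ i).rename ξ) := by
  induction t generalizing ξ σ with
  | var i => rfl
  | lam t ih =>
    have h : (fun i => (upSub σ i).rename (LamCon.upRen ξ)) =
        upSub (fun i => (σ i).rename ξ) := by
      funext i
      cases i with
      | zero => rfl
      | succ i => simp only [upSub, shift, rename_rename]; rfl
    simp [rename, subst, ih, h]
  | app t u iht ihu => simp [rename, subst, iht, ihu]
  | con c => rfl
  | case dom θ t ihθ iht => simp [rename, subst, ihθ, iht]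
  | dai => rfl

theorem subst_subst (t : Tm C) (σ τ : ℕ → Tm C) :
    (t.subst σ).subst τ = t.subst (fun i => (σ i).subst τ) := by
  induction t generalizing σ τ with
  | var i => rfl
  | lam t ih =>
    have h : (fun i => (upSub σ i).subst (upSub τ)) = upSub (fun i => (σ i).subst τ) := by
      funext i
      cases i with
      | zero => rfl
      | succ i => simp only [upSub, shift, rename_subst, subst_rename]; rfl
    simp [subst, ih, h]
  | app t u iht ihu => simp [subst, iht, ihu]
  | con c => rfl
  | case dom θ t ihθ iht => simp [subst, ihθ, iht]
  | dai => rfl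

theorem subst_var (t : Tm C) : t.subst var = t := by
  induction t with
  | var i => rfl
  | lam t ih => simp [subst, upSub_var, ih]
  | app t u iht ihu => simp [subst, iht, ihu]
  | con c => rfl
  | case dom θ t ihθ iht => simp [subst, ihθ, iht]
  | dai => rfl

theorem rename_eq_subst (t : Tm C) (ξ : ℕ → ℕ) : t.rename ξ = t.subst (var ∘ ξ) := by
  rw [← rename_subst, subst_var]

theorem inst_eq (t u : Tm C) : t.inst u = t.subst (scons u var) := by
  unfold inst
  congr 1

theorem shift_subst (t : Tm C) (σ : ℕ → Tm C) :
    t.shift.subst (upSub σ) = (t.subst σ).shift := by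
  simp only [shift, rename_subst, subst_rename]; rfl

theorem shift_subst_scons (t u : Tm C) (σ : ℕ → Tm C) :
    t.shift.subst (scons u σ) = t.subst σ := by
  simp only [shift, rename_subst]; rfl

theorem shift_inst (t u : Tm C) : t.shift.inst u = t := by
  rw [inst_eq, shift_subst_scons, subst_var]

theorem subst_upSub_inst (t u : Tm C) (σ : ℕ → Tm C) :
    (t.subst (upSub σ)).inst u = t.subst (scons u σ) := by
  rw [inst_eq, subst_subst]
  congr 1
  funext i
  cases i with
  | zero => rfl
  | succ i => simp only [upSub, shift_subst_scons, subst_var]; rfl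

theorem inst_subst (t u : Tm C) (σ : ℕ → Tm C) :
    (t.inst u).subst σ = (t.subst (upSub σ)).inst (u.subst σ) := by
  rw [subst_upSub_inst, inst_eq, subst_subst]
  congr 1
  funext i; cases i <;> rfl

theorem app_shift_var_inst (t u : Tm C) : (app t.shift (var 0)).inst u = app t u := by
  conv_rhs => rw [← shift_inst t u]
  rfl

theorem ClosedAt.subst {n m : ℕ} {t : Tm C} (h : t.ClosedAt n) {σ : ℕ → Tm C}
    (hσ : ∀ i < n, (σ i).ClosedAt m) : (t.subst σ).ClosedAt m := by
  have ren : ∀ {t : Tm C} {n m : ℕ} {ξ : ℕ → ℕ}, t.ClosedAt n → (∀ i < n, ξ i < m) →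
      (t.rename ξ).ClosedAt m := by
    intro t
    induction t with
    | var i => intro n m ξ h hξ; exact hξ i h
    | lam t ih =>
      intro n m ξ h hξ
      refine ih (n := n + 1) h ?_
      rintro (_ | i) hi
      · exact Nat.succ_pos _
      · exact Nat.succ_lt_succ (hξ i (Nat.lt_of_succ_lt_succ hi))
    | app t u iht ihu => intro n m ξ h hξ; exact ⟨iht h.1 hξ, ihu h.2 hξ⟩
    | con c => intros; trivial
    | case dom θ t ihθ iht =>
      intro n m ξ h hξ; exact ⟨fun c => ihθ c (h.1 c) hξ, iht h.2 hξ⟩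
    | dai => intros; trivial
  induction t generalizing n m σ with
  | var i => exact hσ i h
  | lam t ih =>
    refine ih (n := n + 1) h ?_
    rintro (_ | i) hi
    · exact Nat.succ_pos _
    · exact ren (hσ i (Nat.lt_of_succ_lt_succ hi)) fun j hj => Nat.succ_lt_succ hj
  | app t u iht ihu => exact ⟨iht h.1 hσ, ihu h.2 hσ⟩
  | con c => trivial
  | case dom θ t ihθ iht => exact ⟨fun c => ihθ c (h.1 c) hσ, iht h.2 hσ⟩
  | dai => trivial

theorem ClosedAt.shift {n : ℕ} {t : Tm C} (h : t.ClosedAt n) : t.shift.ClosedAt (n + 1) := by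
  rw [Tm.shift, rename_eq_subst]
  exact h.subst fun i hi => Nat.succ_lt_succ hi

theorem ClosedAt.of_shift {n : ℕ} {t : Tm C} (h : t.shift.ClosedAt (n + 1)) : t.ClosedAt n := by
  have ren : ∀ {t : Tm C} {n m : ℕ} {ξ : ℕ → ℕ}, (t.rename ξ).ClosedAt m → (∀ i, ξ i < m → i < n) →
      t.ClosedAt n := by
    intro t
    induction t with
    | var i => intro n m ξ h hξ; exact hξ i h
    | lam t ih =>
      intro n m ξ h hξ
      refine ih (m := m + 1) h ?_
      rintro (_ | i) hi
      · exact Nat.succ_pos _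
      · exact Nat.succ_lt_succ (hξ i (Nat.lt_of_succ_lt_succ hi))
    | app t u iht ihu => intro n m ξ h hξ; exact ⟨iht h.1 hξ, ihu h.2 hξ⟩
    | con c => intros; trivial
    | case dom θ t ihθ iht =>
      intro n m ξ h hξ; exact ⟨fun c => ihθ c (h.1 c) hξ, iht h.2 hξ⟩
    | dai => intros; trivial
  exact ren h fun i hi => Nat.lt_of_succ_lt_succ hi

theorem ClosedAt.inst {n : ℕ} {t u : Tm C} (ht : t.ClosedAt (n + 1)) (hu : u.ClosedAt n) :
    (t.inst u).ClosedAt n := by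
  rw [inst_eq]
  refine ht.subst ?_
  rintro (_ | i) hi
  · exact hu
  · exact Nat.lt_of_succ_lt_succ hi

/-- A match failure survives every substitution, while a substitution may create new ones; hence
only this direction. -/
theorem Defined.of_subst {t : Tm C} {σ : ℕ → Tm C} (h : (t.subst σ).Defined) : t.Defined := by
  induction t generalizing σ with
  | var i => trivial
  | lam t ih => exact ih (σ := upSub σ) h
  | app t u iht ihu => exact ⟨iht h.1, ihu h.2⟩
  | con c => trivial
  | case dom θ t ihθ iht =>
    refine ⟨fun c => ihθ c (h.1 c), iht h.2.1, ?_⟩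
    rintro c rfl
    exact h.2.2 c rfl
  | dai => trivial

theorem Defined.rename {t : Tm C} {ξ : ℕ → ℕ} (h : t.Defined) : (t.rename ξ).Defined := by
  induction t generalizing ξ with
  | var i => trivial
  | lam t ih => exact ih h
  | app t u iht ihu => exact ⟨iht h.1, ihu h.2⟩
  | con c => trivial
  | case dom θ t ihθ iht =>
    refine ⟨fun c => ihθ c (h.1 c), iht h.2.1, ?_⟩
    intro c hc
    refine h.2.2 c ?_
    cases t <;> simp_all [Tm.rename]
  | dai => trivial

theorem defined_shift {t : Tm C} : t.shift.Defined ↔ t.Defined :=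
  ⟨fun h => by rw [shift, rename_eq_subst] at h; exact h.of_subst, fun h => h.rename⟩

end Tm

/-! ### Contextual closure -/

namespace Compat

variable {R R' : Tm C → Tm C → Prop}

theorem mono (hR : ∀ t t', R t t' → R' t t') {t t' : Tm C} (h : Compat R t t') :
    Compat R' t t' := by
  induction h with
  | root h => exact .root (hR _ _ h)
  | lam _ ih => exact .lam ih
  | appL u _ ih => exact .appL u ih
  | appR t _ ih => exact .appR t ih
  | caseArg dom θ _ ih => exact .caseArg dom θ ih
  | caseBranch dom θ θ' t c _ hd ih => exact .caseBranch dom θ θ' t c ih hd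

theorem or_iff {t t' : Tm C} :
    Compat (fun a b => R a b ∨ R' a b) t t' ↔ Compat R t t' ∨ Compat R' t t' := by
  constructor
  · intro h
    induction h with
    | root h => exact h.imp .root .root
    | lam _ ih => exact ih.imp .lam .lam
    | appL u _ ih => exact ih.imp (.appL u) (.appL u)
    | appR t _ ih => exact ih.imp (.appR t) (.appR t)
    | caseArg dom θ _ ih => exact ih.imp (.caseArg dom θ) (.caseArg dom θ)
    | caseBranch dom θ θ' t c _ hd ih =>
      exact ih.imp (fun h => .caseBranch dom θ θ' t c h hd) (fun h => .caseBranch dom θ θ' t c h hd)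
  · rintro (h | h)
    · exact h.mono fun _ _ => Or.inl
    · exact h.mono fun _ _ => Or.inr

theorem subst (hR : ∀ (σ : ℕ → Tm C) t t', R t t' → R (t.subst σ) (t'.subst σ)) {t t' : Tm C}
    (h : Compat R t t') (σ : ℕ → Tm C) : Compat R (t.subst σ) (t'.subst σ) := by
  induction h generalizing σ with
  | root h => exact .root (hR σ _ _ h)
  | lam _ ih => exact .lam (ih _)
  | appL u _ ih => exact .appL _ (ih σ)
  | appR t _ ih => exact .appR _ (ih σ)
  | caseArg dom θ _ ih => exact .caseArg dom _ (ih σ)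
  | caseBranch dom θ θ' t c _ hd ih =>
    exact .caseBranch dom _ _ _ c (ih σ) fun d hdc => by rw [hd d hdc]

open Classical in
theorem branch {dom : Finset C} (θ : {c // c ∈ dom} → Tm C) (t : Tm C) (c : {c // c ∈ dom})
    {x : Tm C} (h : Compat R (θ c) x) :
    Compat R (.case dom θ t) (.case dom (Function.update θ c x) t) := by
  refine .caseBranch dom θ _ t c (by simpa using h) fun d hd => ?_
  simp [Function.update_of_ne hd]

theorem star_lam {t t' : Tm C} (h : ReflTransGen (Compat R) t t') :
    ReflTransGen (Compat R) (.lam t) (.lam t') := h.lift _ fun _ _ => .lam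

theorem star_app {t t' u u' : Tm C} (ht : ReflTransGen (Compat R) t t')
    (hu : ReflTransGen (Compat R) u u') : ReflTransGen (Compat R) (.app t u) (.app t' u') :=
  (ht.lift (fun x => Tm.app x u) fun _ _ => .appL u).trans
    (hu.lift (fun x => Tm.app t' x) fun _ _ => .appR t')

open Classical in
theorem star_update {dom : Finset C} (θ : {c // c ∈ dom} → Tm C) (t : Tm C) (c : {c // c ∈ dom})
    {x : Tm C} (h : ReflTransGen (Compat R) (θ c) x) :
    ReflTransGen (Compat R) (.case dom θ t) (.case dom (Function.update θ c x) t) := by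
  -- The lifted path starts at `Function.update θ c (θ c)`, which is `θ`.
  have := h.lift (fun x => Tm.case dom (Function.update θ c x) t) fun a b hab => by
    simpa using branch (Function.update θ c a) t c (x := b) (by simpa using hab)
  simpa [Function.onFun] using this

open Classical in
theorem trans_update {dom : Finset C} (θ : {c // c ∈ dom} → Tm C) (t : Tm C) (c : {c // c ∈ dom})
    {x : Tm C} (h : TransGen (Compat R) (θ c) x) :
    TransGen (Compat R) (.case dom θ t) (.case dom (Function.update θ c x) t) := by
  have := h.lift (fun x => Tm.case dom (Function.update θ c x) t) fun a b hab => by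
    simpa using branch (Function.update θ c a) t c (x := b) (by simpa using hab)
  simpa [Function.onFun] using this

theorem star_branches {dom : Finset C} {θ θ' : {c // c ∈ dom} → Tm C} (t : Tm C)
    (h : ∀ c, ReflTransGen (Compat R) (θ c) (θ' c)) :
    ReflTransGen (Compat R) (.case dom θ t) (.case dom θ' t) := by
  classical
  -- The branches are reduced one after the other, `s` being the set of those already treated;
  -- finiteness of the domain makes this reach all of them.
  have key : ∀ s : Finset {c // c ∈ dom}, ReflTransGen (Compat R) (.case dom θ t)
      (.case dom (fun c => if c ∈ s then θ' c else θ c) t) := by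
    intro s
    induction s using Finset.induction_on with
    | empty => simpa using ReflTransGen.refl
    | insert a s ha ih =>
      refine ih.trans ?_
      have := star_update (R := R) (fun c => if c ∈ s then θ' c else θ c) t a (x := θ' a)
        (by simpa [ha] using h a)
      convert this using 2
      funext d
      by_cases hd : d = a
      · subst hd; simp
      · simp [Finset.mem_insert, hd]
  simpa using key Finset.univ

theorem star_case {dom : Finset C} {θ θ' : {c // c ∈ dom} → Tm C} {t t' : Tm C}
    (h : ∀ c, ReflTransGen (Compat R) (θ c) (θ' c)) (ht : ReflTransGen (Compat R) t t') :
    ReflTransGen (Compat R) (.case dom θ t) (.case dom θ' t') :=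
  (star_branches t h).trans (ht.lift (fun x => Tm.case dom θ' x) fun _ _ => .caseArg dom θ')

theorem star_shift (hR : ∀ (σ : ℕ → Tm C) t t', R t t' → R (t.subst σ) (t'.subst σ)) {t t' : Tm C}
    (h : ReflTransGen (Compat R) t t') : ReflTransGen (Compat R) t.shift t'.shift :=
  h.lift _ fun a b hab => by
    simpa only [Function.onFun, Tm.shift, Tm.rename_eq_subst] using hab.subst hR _

/-- Reduction in the substituted terms. -/
theorem star_subst_right (hR : ∀ (σ : ℕ → Tm C) t t', R t t' → R (t.subst σ) (t'.subst σ))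
    (t : Tm C) {σ τ : ℕ → Tm C} (h : ∀ i, ReflTransGen (Compat R) (σ i) (τ i)) :
    ReflTransGen (Compat R) (t.subst σ) (t.subst τ) := by
  induction t generalizing σ τ with
  | var i => exact h i
  | lam t ih =>
    refine star_lam (ih ?_)
    rintro (_ | i)
    · exact .refl
    · exact star_shift hR (h i)
  | app t u iht ihu => exact star_app (iht h) (ihu h)
  | con c => exact .refl
  | case dom θ t ihθ iht => exact star_case (fun c => ihθ c h) (iht h)
  | dai => exact .refl

theorem star_inst_right (hR : ∀ (σ : ℕ → Tm C) t t', R t t' → R (t.subst σ) (t'.subst σ))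
    (t : Tm C) {u u' : Tm C} (h : ReflTransGen (Compat R) u u') :
    ReflTransGen (Compat R) (t.inst u) (t.inst u') := by
  rw [Tm.inst_eq, Tm.inst_eq]
  refine star_subst_right hR t ?_
  rintro (_ | i)
  · exact h
  · exact .refl

theorem inst_left (hR : ∀ (σ : ℕ → Tm C) t t', R t t' → R (t.subst σ) (t'.subst σ))
    {t t' : Tm C} (h : Compat R t t') (u : Tm C) : Compat R (t.inst u) (t'.inst u) := by
  rw [Tm.inst_eq, Tm.inst_eq]; exact h.subst hR _

theorem shift (hR : ∀ (σ : ℕ → Tm C) t t', R t t' → R (t.subst σ) (t'.subst σ)) {t t' : Tm C}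
    (h : Compat R t t') : Compat R t.shift t'.shift := by
  simpa only [Tm.shift, Tm.rename_eq_subst] using h.subst hR _

end Compat

/-! ### The three groups of rules -/

/-- The computation rules at the root: AppLam and CaseCons. -/
inductive RootEval : Tm C → Tm C → Prop
  | appLam (t u : Tm C) : RootEval (.app (.lam t) u) (t.inst u)
  | caseCons (dom : Finset C) (θ : {c // c ∈ dom} → Tm C) (c : {c // c ∈ dom}) :
      RootEval (.case dom θ (.con c)) (θ c)

/-- The erasing rules at the root: AppDai, LamApp, LamDai and CaseDai. -/
inductive RootErase : Tm C → Tm C → Prop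
  | appDai (u : Tm C) : RootErase (.app .dai u) .dai
  | lamApp (t : Tm C) : RootErase (.lam (.app t.shift (.var 0))) t
  | lamDai : RootErase (.lam .dai) .dai
  | caseDai (dom : Finset C) (θ : {c // c ∈ dom} → Tm C) : RootErase (.case dom θ .dai) .dai

/-- The commutation rules at the root, with case bindings in unbundled form. -/
inductive RootPush : Tm C → Tm C → Prop
  | caseApp (dom : Finset C) (θ : {c // c ∈ dom} → Tm C) (t u : Tm C) :
      RootPush (.case dom θ (.app t u)) (.app (.case dom θ t) u)
  | caseLam (dom : Finset C) (θ : {c // c ∈ dom} → Tm C) (t : Tm C) :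
      RootPush (.case dom θ (.lam t)) (.lam (.case dom (fun c => (θ c).shift) t))

abbrev Eval : Tm C → Tm C → Prop := Compat RootEval
abbrev Erase : Tm C → Tm C → Prop := Compat RootErase
abbrev Push : Tm C → Tm C → Prop := Compat RootPush
abbrev Compute : Tm C → Tm C → Prop := Compat fun a b => RootEval a b ∨ RootPush a b

theorem rootCom_iff {t t' : Tm C} : RootCom t t' ↔ RootPush t t' := by
  constructor
  · rintro (⟨θ, t, u⟩ | ⟨θ, t⟩)
    · exact .caseApp _ _ _ _
    · exact .caseLam _ _ _
  · rintro (⟨dom, θ, t, u⟩ | ⟨dom, θ, t⟩)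
    · exact .caseApp ⟨dom, θ⟩ t u
    · exact .caseLam ⟨dom, θ⟩ t

theorem rootB_iff {t t' : Tm C} : RootB t t' ↔ RootEval t t' ∨ RootErase t t' := by
  constructor
  · rintro (_ | _ | _ | _ | _ | _)
    · exact .inl (.appLam _ _)
    · exact .inr (.appDai _)
    · exact .inr (.lamApp _)
    · exact .inr .lamDai
    · exact .inl (.caseCons _ _ _)
    · exact .inr (.caseDai _ _)
  · rintro ((_ | ⟨dom, θ, c⟩) | (_ | _ | _ | ⟨dom, θ⟩))
    · exact .appLam _ _
    · exact .caseCons ⟨dom, θ⟩ c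
    · exact .appDai _
    · exact .lamApp _
    · exact .lamDai
    · exact .caseDai ⟨dom, θ⟩

theorem comStep_iff {t t' : Tm C} : ComStep t t' ↔ Push t t' :=
  ⟨Compat.mono fun _ _ => rootCom_iff.1, Compat.mono fun _ _ => rootCom_iff.2⟩

theorem compute_iff {t t' : Tm C} : Compute t t' ↔ Eval t t' ∨ Push t t' := Compat.or_iff

theorem step_iff {t t' : Tm C} : Step t t' ↔ Compute t t' ∨ Erase t t' := by
  rw [← Compat.or_iff]
  constructor <;> refine Compat.mono fun a b h => ?_
  · rw [rootB_iff, rootCom_iff] at h; tauto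
  · rw [rootB_iff, rootCom_iff]; tauto

theorem Eval.compute {t t' : Tm C} (h : Eval t t') : Compute t t' := compute_iff.2 (.inl h)
theorem Push.compute {t t' : Tm C} (h : Push t t') : Compute t t' := compute_iff.2 (.inr h)
theorem Compute.step {t t' : Tm C} (h : Compute t t') : Step t t' := step_iff.2 (.inl h)
theorem Push.step {t t' : Tm C} (h : Push t t') : Step t t' := h.compute.step

theorem RootEval.subst (σ : ℕ → Tm C) (t t' : Tm C) (h : RootEval t t') :
    RootEval (t.subst σ) (t'.subst σ) := by
  cases h with
  | appLam t u => rw [Tm.inst_subst]; exact .appLam _ _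
  | caseCons dom θ c => exact .caseCons dom (fun c => (θ c).subst σ) c

theorem RootErase.subst (σ : ℕ → Tm C) (t t' : Tm C) (h : RootErase t t') :
    RootErase (t.subst σ) (t'.subst σ) := by
  cases h with
  | appDai u => exact .appDai _
  | lamApp t =>
    have := RootErase.lamApp (t'.subst σ)
    rwa [← Tm.shift_subst] at this
  | lamDai => exact .lamDai
  | caseDai dom θ => exact .caseDai _ _

theorem RootPush.subst (σ : ℕ → Tm C) (t t' : Tm C) (h : RootPush t t') :
    RootPush (t.subst σ) (t'.subst σ) := by
  cases h with
  | caseApp dom θ t u => exact .caseApp _ _ _ _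
  | caseLam dom θ t =>
    have := RootPush.caseLam dom (fun c => (θ c).subst σ) (t.subst (upSub σ))
    simpa only [← Tm.shift_subst, Tm.subst] using this

theorem rootCompute_subst (σ : ℕ → Tm C) (t t' : Tm C) (h : RootEval t t' ∨ RootPush t t') :
    RootEval (t.subst σ) (t'.subst σ) ∨ RootPush (t.subst σ) (t'.subst σ) :=
  h.imp (RootEval.subst σ t t') (RootPush.subst σ t t')

theorem rootStep_subst (σ : ℕ → Tm C) (t t' : Tm C) (h : RootB t t' ∨ RootCom t t') :
    RootB (t.subst σ) (t'.subst σ) ∨ RootCom (t.subst σ) (t'.subst σ) := by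
  rw [rootB_iff, rootCom_iff] at *
  exact h.imp (Or.imp (RootEval.subst σ t t') (RootErase.subst σ t t')) (RootPush.subst σ t t')

theorem Step.subst {t t' : Tm C} (h : Step t t') (σ : ℕ → Tm C) :
    Step (t.subst σ) (t'.subst σ) := Compat.subst rootStep_subst h σ

theorem Tm.ClosedAt.step {n : ℕ} {t t' : Tm C} (ht : t.ClosedAt n) (h : Step t t') :
    t'.ClosedAt n := by
  induction h generalizing n with
  | root h =>
    rw [rootB_iff, rootCom_iff] at h
    rcases h with ((_ | ⟨dom, θ, c⟩) | (_ | _ | _ | ⟨dom, θ⟩)) | (⟨dom, θ, t, u⟩ | ⟨dom, θ, t⟩)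
    · exact Tm.ClosedAt.inst ht.1 ht.2
    · exact ht.1 c
    · trivial
    · exact ht.1.of_shift
    · trivial
    · trivial
    · exact ⟨⟨ht.1, ht.2.1⟩, ht.2.2⟩
    · exact ⟨fun c => (ht.1 c).shift, ht.2⟩
  | lam _ ih => exact ih (n := n + 1) ht
  | appL u _ ih => exact ⟨ih ht.1, ht.2⟩
  | appR t _ ih => exact ⟨ht.1, ih ht.2⟩
  | caseArg dom θ _ ih => exact ⟨ht.1, ih ht.2⟩
  | caseBranch dom θ θ' t c _ hd ih =>
    refine ⟨fun d => ?_, ht.2⟩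
    by_cases hdc : d = c
    · subst hdc; exact ih (ht.1 d)
    · rw [hd d hdc]; exact ht.1 d

theorem Tm.Closed.star {t t' : Tm C} (ht : t.Closed) (h : ReflTransGen Step t t') : t'.Closed := by
  induction h with
  | refl => exact ht
  | tail _ h ih => exact ih.step h

/-- Commutation steps reflect closedness. -/
theorem Tm.ClosedAt.of_push {n : ℕ} {t t' : Tm C} (ht : t'.ClosedAt n) (h : Push t t') :
    t.ClosedAt n := by
  induction h generalizing n with
  | root h =>
    rcases h with ⟨dom, θ, t, u⟩ | ⟨dom, θ, t⟩
    · exact ⟨ht.1.1, ht.1.2, ht.2⟩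
    · exact ⟨fun c => (ht.1 c).of_shift, ht.2⟩
  | lam _ ih => exact ih (n := n + 1) ht
  | appL u _ ih => exact ⟨ih ht.1, ht.2⟩
  | appR t _ ih => exact ⟨ht.1, ih ht.2⟩
  | caseArg dom θ _ ih => exact ⟨ht.1, ih ht.2⟩
  | caseBranch dom θ θ' t c _ hd ih =>
    refine ⟨fun d => ?_, ht.2⟩
    by_cases hdc : d = c
    · subst hdc; exact ih (ht.1 d)
    · rw [← hd d hdc]; exact ht.1 d

/-- Commutation steps reflect definedness. -/
theorem Tm.Defined.of_push {t t' : Tm C} (ht : t'.Defined) (h : Push t t') : t.Defined := by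
  induction h with
  | root h =>
    rcases h with ⟨dom, θ, t, u⟩ | ⟨dom, θ, t⟩
    · exact ⟨ht.1.1, ⟨ht.1.2.1, ht.2⟩, fun c hc => by cases hc⟩
    · exact ⟨fun c => Tm.defined_shift.1 (ht.1 c), ht.2.1, fun c hc => by cases hc⟩
  | lam _ ih => exact ih ht
  | appL u _ ih => exact ⟨ih ht.1, ht.2⟩
  | appR t _ ih => exact ⟨ht.1, ih ht.2⟩
  | caseArg dom θ h ih =>
    refine ⟨ht.1, ih ht.2.1, ?_⟩
    rintro c rfl
    cases h with
    | root h => cases h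
  | caseBranch dom θ θ' t c _ hd ih =>
    refine ⟨fun d => ?_, ht.2⟩
    by_cases hdc : d = c
    · subst hdc; exact ih (ht.1 d)
    · rw [← hd d hdc]; exact ht.1 d

theorem Tm.Defined.of_push_star {t t' : Tm C} (ht : t'.Defined) (h : ReflTransGen Push t t') :
    t.Defined := by
  induction h using ReflTransGen.head_induction_on with
  | refl => exact ht
  | head h _ ih => exact ih.of_push h

/-! ### Sizes -/

def Tm.size : Tm C → ℕ
  | .var _ => 1
  | .lam t => t.size + 1
  | .app t u => t.size + u.size + 1
  | .con _ => 1
  | .case _ θ t => (∑ c, (θ c).size) + t.size + 1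
  | .dai => 1

/-- The sum of the sizes of the arguments of case constructs. -/
def Tm.weight : Tm C → ℕ
  | .var _ => 0
  | .lam t => t.weight
  | .app t u => t.weight + u.weight
  | .con _ => 0
  | .case _ θ t => (∑ c, (θ c).weight) + t.weight + t.size
  | .dai => 0

theorem Tm.size_rename (t : Tm C) (ξ : ℕ → ℕ) : (t.rename ξ).size = t.size := by
  induction t generalizing ξ with
  | var i => rfl
  | lam t ih => simp [rename, size, ih]
  | app t u iht ihu => simp [rename, size, iht, ihu]
  | con c => rfl
  | case dom θ t ihθ iht => simp [rename, size, ihθ, iht]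
  | dai => rfl

theorem Tm.weight_rename (t : Tm C) (ξ : ℕ → ℕ) : (t.rename ξ).weight = t.weight := by
  induction t generalizing ξ with
  | var i => rfl
  | lam t ih => simp [rename, weight, ih]
  | app t u iht ihu => simp [rename, weight, iht, ihu]
  | con c => rfl
  | case dom θ t ihθ iht => simp [rename, weight, ihθ, iht, size_rename]
  | dai => rfl

theorem sum_lt_of_update {dom : Finset C} {f g : {c // c ∈ dom} → ℕ} (c : {c // c ∈ dom})
    (hc : g c < f c) (h : ∀ d, d ≠ c → g d = f d) : ∑ d, g d < ∑ d, f d := by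
  refine Finset.sum_lt_sum (fun d _ => ?_) ⟨c, Finset.mem_univ c, hc⟩
  by_cases hd : d = c
  · subst hd; exact hc.le
  · exact (h d hd).le

theorem Erase.size_lt {t t' : Tm C} (h : Erase t t') : t'.size < t.size := by
  induction h with
  | root h =>
    rcases h with _ | _ | _ | _
    · simp only [Tm.size]; omega
    · simp only [Tm.size, Tm.shift, Tm.size_rename]; omega
    · simp only [Tm.size]; omega
    · simp only [Tm.size]; omega
  | lam _ ih => simpa [Tm.size] using ih
  | appL u _ ih => simpa [Tm.size] using ih
  | appR t _ ih => simpa [Tm.size] using ih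
  | caseArg dom θ _ ih => simpa [Tm.size] using ih
  | caseBranch dom θ θ' t c _ hd ih =>
    have := sum_lt_of_update (f := fun d => (θ d).size) (g := fun d => (θ' d).size) c ih
      fun d hdc => by rw [hd d hdc]
    simpa [Tm.size] using this

theorem Push.size_eq {t t' : Tm C} (h : Push t t') : t'.size = t.size := by
  induction h with
  | root h =>
    rcases h with ⟨dom, θ, t, u⟩ | ⟨dom, θ, t⟩
    · simp only [Tm.size]; omega
    · simp only [Tm.size, Tm.shift, Tm.size_rename]; omega
  | lam _ ih => simpa [Tm.size] using ih
  | appL u _ ih => simpa [Tm.size] using ih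
  | appR t _ ih => simpa [Tm.size] using ih
  | caseArg dom θ _ ih => simpa [Tm.size] using ih
  | caseBranch dom θ θ' t c _ hd ih =>
    simp only [Tm.size, Nat.add_right_cancel_iff]
    refine Finset.sum_congr rfl fun d _ => ?_
    by_cases hdc : d = c
    · subst hdc; exact ih
    · rw [hd d hdc]

/-- A commutation moves a case construct onto a strictly smaller argument and copies nothing. Inside
an argument of another case, `Push.size_eq` keeps the contribution of the outer case unchanged. -/
theorem Push.weight_lt {t t' : Tm C} (h : Push t t') : t'.weight < t.weight := by
  induction h with
  | root h =>
    rcases h with ⟨dom, θ, t, u⟩ | ⟨dom, θ, t⟩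
    · simp only [Tm.weight, Tm.size]; omega
    · simp only [Tm.weight, Tm.shift, Tm.weight_rename, Tm.size]; omega
  | lam _ ih => simpa [Tm.weight] using ih
  | appL u _ ih => simpa [Tm.weight] using ih
  | appR t _ ih => simpa [Tm.weight] using ih
  | caseArg dom θ h ih =>
    simp only [Tm.weight, Push.size_eq h]; omega
  | caseBranch dom θ θ' t c _ hd ih =>
    have := sum_lt_of_update (f := fun d => (θ d).weight) (g := fun d => (θ' d).weight) c ih
      fun d hdc => by rw [hd d hdc]
    simpa [Tm.weight] using this

theorem Push.star_weight_le {t t' : Tm C} (h : ReflTransGen Push t t') : t'.weight ≤ t.weight := by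
  induction h with
  | refl => exact le_rfl
  | tail _ h ih => exact h.weight_lt.le.trans ih

/-! ### Postponement of erasing steps -/

open Classical in
-- Of the erasing rules, only η can create a computation redex at the place of the erased term. The
-- η-redex is then either applied, and β does the work of η, or under a case construct, which two
-- commutations bring inside the abstraction. At least one computation step remains, as the
-- termination argument requires.
theorem Erase.postpone {t s : Tm C} (h : Erase t s) : ∀ {r : Tm C}, Compute s r →
    ∃ t₁, TransGen Compute t t₁ ∧ ReflTransGen Erase t₁ r := by
  induction h with
  | root h =>
    intro r hr
    rcases h with _ | _ | _ | _
    · rcases hr with ((h | h) | _) <;> cases h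
    · exact ⟨_, .single (.lam (.appL _ (hr.shift rootCompute_subst))), .single (.root (.lamApp r))⟩
    · rcases hr with ((h | h) | _) <;> cases h
    · rcases hr with ((h | h) | _) <;> cases h
  | lam _ ih =>
    intro r hr
    cases hr with
    | root h => rcases h with (h | h) <;> cases h
    | lam h =>
      obtain ⟨t₁, h₁, h₂⟩ := ih h
      exact ⟨_, h₁.lift _ fun _ _ => .lam, Compat.star_lam h₂⟩
  | @appL a a' u ha ih =>
    intro r hr
    cases hr with
    | root h =>
      rcases h with (h | h)
      · cases h with
        | appLam p' =>
          cases ha with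
          | root h =>
            cases h with
            | lamApp =>
              -- In `(λx.(λy.p)x)u`, a first β-step has the effect of the η-step and a second one
              -- contracts the redex it exposes; no erasure is left over.
              refine ⟨_, .tail (.single (.root (.inl (.appLam _ _)))) ?_, .refl⟩
              rw [Tm.app_shift_var_inst]
              exact .root (.inl (.appLam _ _))
          | lam h =>
            exact ⟨_, .single (.root (.inl (.appLam _ _))),
              .single (h.inst_left RootErase.subst u)⟩
      · cases h
    | appL _ h =>
      obtain ⟨t₁, h₁, h₂⟩ := ih h
      exact ⟨_, h₁.lift (fun x => Tm.app x u) fun _ _ => .appL u, Compat.star_app h₂ .refl⟩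
    | appR _ h => exact ⟨_, .single (.appR _ h), .single (.appL _ ha)⟩
  | @appR a u u' hu ih =>
    intro r hr
    cases hr with
    | root h =>
      rcases h with (h | h)
      · cases h with
        | appLam p =>
          exact ⟨_, .single (.root (.inl (.appLam _ _))),
            Compat.star_inst_right RootErase.subst p (.single hu)⟩
      · cases h
    | appL _ h => exact ⟨_, .single (.appL _ h), .single (.appR _ hu)⟩
    | appR _ h =>
      obtain ⟨t₁, h₁, h₂⟩ := ih h
      exact ⟨_, h₁.lift (fun x => Tm.app a x) fun _ _ => .appR a, Compat.star_app .refl h₂⟩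
  | @caseArg dom θ a a' ha ih =>
    intro r hr
    cases hr with
    | root h =>
      have push : ∀ q : Tm C, Compute (.case dom θ (.lam (.app q.shift (.var 0))))
          (.lam (.case dom (fun c => (θ c).shift) (.app q.shift (.var 0)))) :=
        fun q => .root (.inr (.caseLam _ _ _))
      have push' : ∀ q : Tm C,
          Compute (.lam (.case dom (fun c => (θ c).shift) (.app q.shift (.var 0))))
            (.lam (.app (Tm.case dom θ q).shift (.var 0))) :=
        fun q => .lam (.root (.inr (.caseApp _ _ _ _)))
      -- From `{|θ|}·λx.a'x`, two commutations give `λx.({|θ|}·a')x`; the computation of `{|θ|}·a'`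
      -- is then carried out inside, and η is applied at the end.
      have eta : ∀ q, TransGen Compute (Tm.case dom θ a') q → a = .lam (.app a'.shift (.var 0)) →
          ∃ t₁, TransGen Compute (Tm.case dom θ a) t₁ ∧ ReflTransGen Erase t₁ q := by
        rintro q hq rfl
        refine ⟨_, (TransGen.single (push a')).tail (push' a') |>.trans
          (hq.lift (fun x => Tm.lam (.app x.shift (.var 0))) fun x y hxy =>
            .lam (.appL _ (hxy.shift rootCompute_subst))), .single (.root (.lamApp q))⟩
      have hr : Compute (Tm.case dom θ a') r := .root h
      cases ha with
      | root h' =>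
        cases h' with
        | lamApp => exact eta r (.single hr) rfl
        | appDai => rcases h with (h | h) <;> cases h
        | lamDai => rcases h with (h | h) <;> cases h
        | caseDai => rcases h with (h | h) <;> cases h
      | lam h' =>
        rcases h with (h | h)
        · cases h
        · cases h
          exact ⟨_, .single (.root (.inr (.caseLam _ _ _))), .single (.lam (.caseArg _ _ h'))⟩
      | appL _ h' =>
        rcases h with (h | h)
        · cases h
        · cases h
          exact ⟨_, .single (.root (.inr (.caseApp _ _ _ _))),
            .single (.appL _ (.caseArg _ _ h'))⟩
      | appR _ h' =>
        rcases h with (h | h)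
        · cases h
        · cases h
          exact ⟨_, .single (.root (.inr (.caseApp _ _ _ _))), .single (.appR _ h')⟩
      | caseArg _ _ h' => rcases h with (h | h) <;> cases h
      | caseBranch _ _ _ _ _ h' => rcases h with (h | h) <;> cases h
    | caseArg _ _ h =>
      obtain ⟨t₁, h₁, h₂⟩ := ih h
      exact ⟨_, h₁.lift (fun x => Tm.case dom θ x) fun _ _ => .caseArg dom θ,
        Compat.star_case (fun _ => .refl) h₂⟩
    | caseBranch _ _ θ' _ c h hd =>
      exact ⟨_, .single (.caseBranch _ _ θ' _ c h hd), .single (.caseArg _ _ ha)⟩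
  | caseBranch dom θ θ' a c hc hd ih =>
    intro r hr
    have hstar : ∀ d, ReflTransGen Erase (θ d) (θ' d) := by
      intro d
      by_cases hdc : d = c
      · subst hdc; exact .single hc
      · rw [hd d hdc]
    cases hr with
    | root h =>
      rcases h with (h | h)
      · cases h with
        | caseCons _ _ e => exact ⟨_, .single (.root (.inl (.caseCons _ _ e))), hstar e⟩
      · cases h with
        | caseApp =>
          exact ⟨_, .single (.root (.inr (.caseApp _ _ _ _))),
            Compat.star_app (Compat.star_branches _ hstar) .refl⟩
        | caseLam =>
          exact ⟨_, .single (.root (.inr (.caseLam _ _ _))),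
            Compat.star_lam (Compat.star_branches _ fun d =>
              Compat.star_shift RootErase.subst (hstar d))⟩
    | caseArg _ _ h => exact ⟨_, .single (.caseArg _ _ h), Compat.star_branches _ hstar⟩
    | caseBranch _ _ θ'' _ e he hd' =>
      by_cases hec : e = c
      · subst hec
        obtain ⟨t₁, h₁, h₂⟩ := ih he
        refine ⟨_, Compat.trans_update θ a e h₁, Compat.star_branches _ fun d => ?_⟩
        by_cases hde : d = e
        · subst hde; simpa using h₂
        · rw [Function.update_of_ne hde, hd' d hde, hd d hde]
      · rw [hd e hec] at he
        refine ⟨_, .single (Compat.branch θ a e he), Compat.star_branches _ fun d => ?_⟩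
        by_cases hde : d = e
        · subst hde; simpa using .refl
        · rw [Function.update_of_ne hde, hd' d hde]; exact hstar d

/-- An erasing step cannot create a match failure that computation steps do not create. -/
theorem Erase.undefined {t s : Tm C} (h : Erase t s) (hs : ¬ s.Defined) :
    ∃ t₁, ReflTransGen Compute t t₁ ∧ ¬ t₁.Defined := by
  induction h with
  | root h =>
    rcases h with _ | _ | _ | _
    · exact absurd trivial hs
    · exact ⟨_, .refl, fun h => hs (Tm.defined_shift.1 h.1)⟩
    · exact absurd trivial hs
    · exact absurd trivial hs
  | lam _ ih =>
    obtain ⟨t₁, h₁, h₂⟩ := ih hs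
    exact ⟨_, Compat.star_lam h₁, h₂⟩
  | @appL a a' u ha ih =>
    by_cases ha' : a'.Defined
    · exact ⟨_, .refl, fun h => hs ⟨ha', h.2⟩⟩
    · obtain ⟨t₁, h₁, h₂⟩ := ih ha'
      exact ⟨_, Compat.star_app h₁ .refl, fun h => h₂ h.1⟩
  | @appR a u u' hu ih =>
    by_cases hu' : u'.Defined
    · exact ⟨_, .refl, fun h => hs ⟨h.1, hu'⟩⟩
    · obtain ⟨t₁, h₁, h₂⟩ := ih hu'
      exact ⟨_, Compat.star_app .refl h₁, fun h => h₂ h.2⟩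
  | @caseArg dom θ a a' ha ih =>
    by_cases ha' : a'.Defined
    · by_cases hθ : ∀ c, (θ c).Defined
      · have : ∃ c, a' = .con c ∧ c ∉ dom := by
          by_contra hcon
          push Not at hcon
          exact hs ⟨hθ, ha', hcon⟩
        obtain ⟨c, rfl, hc⟩ := this
        -- Only η can erase to a constructor. The failure `{|θ|}·c` is already reached from
        -- `{|θ|}·λx.cx` by two commutations, inside `λx.({|θ|}·c)x`.
        cases ha with
        | root h =>
          cases h
          refine ⟨_, .tail (.single (.root (.inr (.caseLam _ _ _))))
            (.lam (.root (.inr (.caseApp _ _ _ _)))), fun h => hc (h.1.2.2 c rfl)⟩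
      · exact ⟨_, .refl, fun h => hθ h.1⟩
    · obtain ⟨t₁, h₁, h₂⟩ := ih ha'
      exact ⟨_, Compat.star_case (fun _ => .refl) h₁, fun h => h₂ h.2.1⟩
  | caseBranch dom θ θ' a c hc hd ih =>
    by_cases hc' : (θ' c).Defined
    · refine ⟨_, .refl, fun h => hs ⟨fun d => ?_, h.2⟩⟩
      by_cases hdc : d = c
      · subst hdc; exact hc'
      · rw [hd d hdc]; exact h.1 d
    · obtain ⟨t₁, h₁, h₂⟩ := ih hc'
      classical
      exact ⟨_, Compat.star_update θ a c h₁, fun h => h₂ (by simpa using h.1 c)⟩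

/-! ### Confluence of commutation, and commutation with computation -/

open Classical in
-- The commutation rules have no critical pair and neither copy nor discard a subterm, so at most
-- one step on each side closes the diagram.
theorem Push.diamond {t a : Tm C} (h : Push t a) : ∀ {b : Tm C}, Push t b →
    ∃ d, ReflGen Push a d ∧ ReflGen Push b d := by
  have caseRoot : ∀ {t a b : Tm C}, RootPush t a → Push t b →
      ∃ d, ReflGen Push a d ∧ ReflGen Push b d := by
    intro t a b h hb
    cases h with
    | caseApp dom θ t u =>
      cases hb with
      | root h => cases h; exact ⟨_, .refl, .refl⟩
      | caseArg _ _ h =>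
        cases h with
        | root h => cases h
        | appL _ h => exact ⟨_, .single (.appL _ (.caseArg _ _ h)), .single (.root (.caseApp _ _ _ _))⟩
        | appR _ h => exact ⟨_, .single (.appR _ h), .single (.root (.caseApp _ _ _ _))⟩
      | caseBranch _ _ θ' _ c h hd =>
        exact ⟨_, .single (.appL _ (.caseBranch _ _ _ _ c h hd)),
          .single (.root (.caseApp _ _ _ _))⟩
    | caseLam dom θ t =>
      cases hb with
      | root h => cases h; exact ⟨_, .refl, .refl⟩
      | caseArg _ _ h =>
        cases h with
        | root h => cases h
        | lam h => exact ⟨_, .single (.lam (.caseArg _ _ h)), .single (.root (.caseLam _ _ _))⟩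
      | caseBranch _ _ θ' _ c h hd =>
        exact ⟨_, .single (.lam (.caseBranch _ _ _ _ c (h.shift RootPush.subst)
          fun d hdc => by rw [hd d hdc])), .single (.root (.caseLam _ _ _))⟩
  have lift : ∀ (f : Tm C → Tm C), (∀ x y, Push x y → Push (f x) (f y)) → ∀ {x y : Tm C},
      ReflGen Push x y → ReflGen Push (f x) (f y) := by
    rintro f hf x y (_ | h)
    · exact .refl
    · exact .single (hf _ _ h)
  induction h with
  | root h => exact caseRoot h
  | lam _ ih =>
    intro b hb
    cases hb with
    | root h => cases h
    | lam h =>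
      obtain ⟨d, h₁, h₂⟩ := ih h
      exact ⟨_, lift _ (fun _ _ => .lam) h₁, lift _ (fun _ _ => .lam) h₂⟩
  | @appL a a' u ha ih =>
    intro b hb
    cases hb with
    | root h => cases h
    | appL _ h =>
      obtain ⟨d, h₁, h₂⟩ := ih h
      exact ⟨_, lift (fun x => Tm.app x u) (fun _ _ => .appL u) h₁,
        lift (fun x => Tm.app x u) (fun _ _ => .appL u) h₂⟩
    | appR _ h => exact ⟨_, .single (.appR _ h), .single (.appL _ ha)⟩
  | @appR a u u' hu ih =>
    intro b hb
    cases hb with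
    | root h => cases h
    | appL _ h => exact ⟨_, .single (.appL _ h), .single (.appR _ hu)⟩
    | appR _ h =>
      obtain ⟨d, h₁, h₂⟩ := ih h
      exact ⟨_, lift _ (fun _ _ => .appR a) h₁, lift _ (fun _ _ => .appR a) h₂⟩
  | @caseArg dom θ a a' ha ih =>
    intro b hb
    cases hb with
    | root h =>
      obtain ⟨d, h₁, h₂⟩ := caseRoot h (.caseArg dom θ ha)
      exact ⟨d, h₂, h₁⟩
    | caseArg _ _ h =>
      obtain ⟨d, h₁, h₂⟩ := ih h
      exact ⟨_, lift _ (fun _ _ => .caseArg dom θ) h₁, lift _ (fun _ _ => .caseArg dom θ) h₂⟩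
    | caseBranch _ _ θ' _ c h hd =>
      exact ⟨_, .single (.caseBranch _ _ θ' _ c h hd), .single (.caseArg _ _ ha)⟩
  | caseBranch dom θ θ' a c hc hd ih =>
    intro b hb
    cases hb with
    | root h =>
      obtain ⟨d, h₁, h₂⟩ := caseRoot h (.caseBranch dom θ θ' a c hc hd)
      exact ⟨d, h₂, h₁⟩
    | caseArg _ _ h => exact ⟨_, .single (.caseArg _ _ h), .single (.caseBranch _ _ θ' _ c hc hd)⟩
    | caseBranch _ _ θ'' _ e he hd' =>
      by_cases hec : e = c
      · subst hec
        obtain ⟨x, h₁, h₂⟩ := ih he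
        have key : ∀ θ₁ : {c // c ∈ dom} → Tm C, ReflGen Push (θ₁ e) x → (∀ d, d ≠ e → θ₁ d = θ d) →
            ReflGen Push (.case dom θ₁ a) (.case dom (Function.update θ e x) a) := by
          intro θ₁ h hθ₁
          have := lift (fun x => Tm.case dom (Function.update θ₁ e x) a) (fun x y hxy => by
            simpa using Compat.branch (Function.update θ₁ e x) a e (x := y) (by simpa using hxy)) h
          have heq : Function.update θ₁ e x = Function.update θ e x := by
            funext d
            by_cases hde : d = e
            · subst hde; simp
            · simp [hde, hθ₁ d hde]
          simpa [heq] using this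
        exact ⟨_, key θ' h₁ hd, key θ'' h₂ hd'⟩
      · refine ⟨.case dom (Function.update θ' e (θ'' e)) a,
          .single (Compat.branch θ' a e (by rwa [hd e hec])),
          .single (.caseBranch _ _ _ _ c ?_ ?_)⟩
        · rw [hd' c (Ne.symm hec), Function.update_of_ne (Ne.symm hec)]; exact hc
        · intro d hdc
          by_cases hde : d = e
          · subst hde; simp
          · rw [Function.update_of_ne hde, hd d hdc, hd' d hde]

theorem Push.confluent {t a b : Tm C} (ha : ReflTransGen Push t a) (hb : ReflTransGen Push t b) :
    ∃ d, ReflTransGen Push a d ∧ ReflTransGen Push b d := by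
  refine Relation.church_rosser (fun x y z hy hz => ?_) ha hb
  obtain ⟨d, h₁, h₂⟩ := hy.diamond hz
  exact ⟨d, h₁, h₂.to_reflTransGen⟩

open Classical in
-- The only overlap is `{|θ|}·((λx.p)u)`: once the case has been moved into the application, a
-- further commutation with `λ` is needed to expose the β-redex again. Several commutations may be
-- needed below `s`, since β can copy `u`. Exactly one evaluation step is kept on the commuted side,
-- so no computation is lost.
theorem Push.eval {t a : Tm C} (h : Push t a) : ∀ {s : Tm C}, Eval t s →
    ∃ x s', ReflTransGen Push a x ∧ Eval x s' ∧ ReflTransGen Push s s' := by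
  induction h with
  | root h =>
    intro s hs
    cases h with
    | caseApp dom θ t u =>
      cases hs with
      | root h => cases h
      | caseArg _ _ h =>
        cases h with
        | root h =>
          cases h with
          | appLam p =>
            refine ⟨_, _, .single (.appL _ (.root (.caseLam _ _ _))), .root (.appLam _ _), ?_⟩
            have : (Tm.case dom (fun c => (θ c).shift) p).inst u = Tm.case dom θ (p.inst u) := by
              simp only [Tm.inst_eq, Tm.subst, Tm.shift_subst_scons, Tm.subst_var]
            rw [this]
        | appL _ h =>
          exact ⟨_, _, .refl, .appL _ (.caseArg _ _ h), .single (.root (.caseApp _ _ _ _))⟩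
        | appR _ h => exact ⟨_, _, .refl, .appR _ h, .single (.root (.caseApp _ _ _ _))⟩
      | caseBranch _ _ θ' _ c h hd =>
        exact ⟨_, _, .refl, .appL _ (.caseBranch _ _ θ' _ c h hd),
          .single (.root (.caseApp _ _ _ _))⟩
    | caseLam dom θ t =>
      cases hs with
      | root h => cases h
      | caseArg _ _ h =>
        cases h with
        | root h => cases h
        | lam h => exact ⟨_, _, .refl, .lam (.caseArg _ _ h), .single (.root (.caseLam _ _ _))⟩
      | caseBranch _ _ θ' _ c h hd =>
        exact ⟨_, _, .refl, .lam (.caseBranch _ _ _ _ c (h.shift RootEval.subst)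
          fun d hdc => by rw [hd d hdc]), .single (.root (.caseLam _ _ _))⟩
  | lam _ ih =>
    intro s hs
    cases hs with
    | root h => cases h
    | lam h =>
      obtain ⟨x, s', h₁, h₂, h₃⟩ := ih h
      exact ⟨_, _, Compat.star_lam h₁, .lam h₂, Compat.star_lam h₃⟩
  | @appL a a' u ha ih =>
    intro s hs
    cases hs with
    | root h =>
      cases h with
      | appLam p =>
        cases ha with
        | root h => cases h
        | lam h =>
          exact ⟨_, _, .refl, .root (.appLam _ _), .single (h.inst_left RootPush.subst u)⟩
    | appL _ h =>
      obtain ⟨x, s', h₁, h₂, h₃⟩ := ih h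
      exact ⟨_, _, Compat.star_app h₁ .refl, .appL _ h₂, Compat.star_app h₃ .refl⟩
    | appR _ h => exact ⟨_, _, .refl, .appR _ h, .single (.appL _ ha)⟩
  | @appR a u u' hu ih =>
    intro s hs
    cases hs with
    | root h =>
      cases h with
      | appLam p =>
        exact ⟨_, _, .refl, .root (.appLam _ _),
          Compat.star_inst_right RootPush.subst p (.single hu)⟩
    | appL _ h => exact ⟨_, _, .refl, .appL _ h, .single (.appR _ hu)⟩
    | appR _ h =>
      obtain ⟨x, s', h₁, h₂, h₃⟩ := ih h
      exact ⟨_, _, Compat.star_app .refl h₁, .appR _ h₂, Compat.star_app .refl h₃⟩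
  | @caseArg dom θ a a' ha ih =>
    intro s hs
    cases hs with
    | root h =>
      cases h with
      | caseCons =>
        cases ha with
        | root h => cases h
    | caseArg _ _ h =>
      obtain ⟨x, s', h₁, h₂, h₃⟩ := ih h
      exact ⟨_, _, Compat.star_case (fun _ => .refl) h₁, .caseArg _ _ h₂,
        Compat.star_case (fun _ => .refl) h₃⟩
    | caseBranch _ _ θ' _ c h hd =>
      exact ⟨_, _, .refl, .caseBranch _ _ θ' _ c h hd, .single (.caseArg _ _ ha)⟩
  | caseBranch dom θ θ' a c hc hd ih =>
    intro s hs
    have hstar : ∀ d, ReflTransGen Push (θ d) (θ' d) := by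
      intro d
      by_cases hdc : d = c
      · subst hdc; exact .single hc
      · rw [hd d hdc]
    cases hs with
    | root h =>
      cases h with
      | caseCons _ _ e => exact ⟨_, _, .refl, .root (.caseCons _ _ e), hstar e⟩
    | caseArg _ _ h =>
      exact ⟨_, _, .refl, .caseArg _ _ h, .single (.caseBranch _ _ θ' _ c hc hd)⟩
    | caseBranch _ _ θ'' _ e he hd' =>
      by_cases hec : e = c
      · subst hec
        obtain ⟨x, s', h₁, h₂, h₃⟩ := ih he
        refine ⟨.case dom (Function.update θ' e x) a, .case dom (Function.update θ'' e s') a,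
          Compat.star_update θ' a e h₁, .caseBranch _ _ _ _ e (by simpa using h₂) fun d hde => ?_,
          Compat.star_update θ'' a e h₃⟩
        rw [Function.update_of_ne hde, Function.update_of_ne hde, hd d hde, hd' d hde]
      · refine ⟨_, .case dom (Function.update θ' e (θ'' e)) a, .refl,
          Compat.branch θ' a e (by rwa [hd e hec]), Compat.star_branches _ fun d => ?_⟩
        by_cases hde : d = e
        · subst hde; simpa using .refl
        · rw [Function.update_of_ne hde, hd' d hde]; exact hstar d

theorem Push.star_eval {t a s : Tm C} (h : ReflTransGen Push t a) (hs : Eval t s) :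
    ∃ x s', ReflTransGen Push a x ∧ Eval x s' ∧ ReflTransGen Push s s' := by
  induction hn : t.weight using Nat.strong_induction_on generalizing t a s with
  | _ n ih =>
    cases h using ReflTransGen.head_induction_on with
    | refl => exact ⟨_, _, .refl, hs, .refl⟩
    | head h₁ h₂ =>
      -- Local commutation is applied to the first step, confluence joins its outcome `x` to `a`,
      -- and the induction hypothesis applies at `x`, which is strictly lighter than `t`.
      obtain ⟨x, s₁, hx, hxs, hss⟩ := h₁.eval hs
      obtain ⟨y, hxy, hay⟩ := Push.confluent hx h₂
      have hlt : x.weight < n := hn ▸ (Push.star_weight_le hx).trans_lt h₁.weight_lt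
      obtain ⟨z, s', hz, hzs, hs'⟩ := ih _ hlt hxy hxs rfl
      exact ⟨z, s', hay.trans hz, hzs, hss.trans hs'⟩

/-! ### Perfect normalisation -/

/-- Perfect normalisation with respect to an arbitrary reduction relation: all reducts are defined
and there is no infinite reduction. -/
inductive Good (R : Tm C → Tm C → Prop) : Tm C → Prop
  | mk {t : Tm C} : t.Defined → (∀ t', R t t' → Good R t') → Good R t

namespace Good

variable {R R' : Tm C → Tm C → Prop} {t t' : Tm C}

theorem defined (h : Good R t) : t.Defined := by cases h; assumption

theorem step (h : Good R t) (hR : R t t') : Good R t' := by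
  cases h with
  | mk _ h => exact h _ hR

theorem star (h : Good R t) (hR : ReflTransGen R t t') : Good R t' := by
  induction hR with
  | refl => exact h
  | tail _ hR ih => exact ih.step hR

theorem mono (hR : ∀ a b, R' a b → R a b) (h : Good R t) : Good R' t := by
  induction h with
  | mk hd _ ih => exact .mk hd fun t' h => ih t' (hR _ _ h)

theorem acc (h : Good R t) : Acc (fun u t => R t u) t := by
  induction h with
  | mk _ _ ih => exact ⟨_, ih⟩

theorem acc_transGen (h : Good R t) : Acc (fun u t => TransGen R t u) t := by
  have := h.acc.transGen
  convert this using 1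
  funext a b
  exact propext Relation.transGen_swap.symm

end Good

theorem perfectlyNormalising_iff {t : Tm C} : PerfectlyNormalising t ↔ Good Step t := by
  constructor
  · rintro ⟨h, hd⟩
    induction h with
    | intro t _ ih => exact .mk (hd t .refl) fun t' h => ih t' h fun u hu => hd u (.head h hu)
  · exact fun h => ⟨h.acc, fun u hu => (h.star hu).defined⟩

/-- Lexicographic induction on the computations of `t'`, then on the weight of `t`. An evaluation
step of `t` forces at least one step of `t'`; a commutation step of `t` either moves `t'` or, when
the join is `t'` itself, lowers the weight. -/
theorem Good.of_push_star {t t' : Tm C} (h : Good Compute t') (ht : ReflTransGen Push t t') :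
    Good Compute t := by
  have hacc := h.acc_transGen
  induction hacc generalizing t with
  | intro t' _ ih =>
    induction hn : t.weight using Nat.strong_induction_on generalizing t with
    | _ n ihn =>
      refine .mk (h.defined.of_push_star ht) fun s hs => ?_
      rcases compute_iff.1 hs with hs | hs
      · obtain ⟨x, s', hx, hxs, hss⟩ := Push.star_eval ht hs
        have htr : TransGen Compute t' s' :=
          .tail' (hx.lift id fun _ _ h => h.compute) hxs.compute
        exact ih s' htr (h.star htr.to_reflTransGen) hss
      · obtain ⟨d, h₁, h₂⟩ := Push.confluent ht (.single hs)
        rcases Relation.reflTransGen_iff_eq_or_transGen.1 h₁ with rfl | h₁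
        · exact ihn _ (hn ▸ hs.weight_lt) h₂ rfl
        · have htr : TransGen Compute t' d := h₁.lift id fun _ _ h => h.compute
          exact ih d htr (h.star htr.to_reflTransGen) h₂

/-- Passing one erasing step may turn a computation step into several, and these must still pass the
earlier erasing steps. The first one is handled by induction on the number of erasures; the
following ones start from a proper computation reduct of `t`, hence the induction on the
computations of `t`. -/
theorem Good.star_postpone {t : Tm C} (ht : Good Compute t) : ∀ {s r : Tm C},
    ReflTransGen Erase t s → Compute s r →
      ∃ t₁, TransGen Compute t t₁ ∧ ReflTransGen Erase t₁ r := by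
  have hacc := ht.acc_transGen
  induction hacc with
  | intro t _ ih =>
    intro s r hts hsr
    induction hts generalizing r with
    | refl => exact ⟨r, .single hsr, .refl⟩
    | tail _ h ihs =>
      obtain ⟨x, hx, hxr⟩ := h.postpone hsr
      have key : ∃ t₁, TransGen Compute t t₁ ∧ ReflTransGen Erase t₁ x := by
        clear hxr
        induction hx with
        | single h => exact ihs h
        | tail _ h ihx =>
          obtain ⟨t₁, h₁, h₂⟩ := ihx
          obtain ⟨t₂, h₃, h₄⟩ := ih t₁ h₁ (ht.star h₁.to_reflTransGen) h₂ h
          exact ⟨t₂, h₁.trans h₃, h₄⟩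
      obtain ⟨t₁, h₁, h₂⟩ := key
      exact ⟨t₁, h₁, h₂.trans hxr⟩

/-- A nonempty computation is postponed to a proper computation reduct of `t`, where induction
applies. If there is none, `Erase.undefined` turns a failure created by the last erasure into one
present before it or reached from there by a nonempty computation. -/
theorem Good.defined_of_erase {t : Tm C} (ht : Good Compute t) : ∀ {s x : Tm C},
    ReflTransGen Erase t s → ReflTransGen Compute s x → x.Defined := by
  have hacc := ht.acc_transGen
  induction hacc with
  | intro t _ ih =>
    have key : ∀ {s y x : Tm C}, ReflTransGen Erase t s → Compute s y →
        ReflTransGen Compute y x → x.Defined := by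
      intro s y x hts hsy hyx
      obtain ⟨t₁, h₁, h₂⟩ := ht.star_postpone hts hsy
      exact ih t₁ h₁ (ht.star h₁.to_reflTransGen) h₂ hyx
    intro s x hts hsx
    cases hsx using ReflTransGen.head_induction_on with
    | head h₁ h₂ => exact key hts h₁ h₂
    | refl =>
      induction hts with
      | refl => exact ht.defined
      | tail hts h ihs =>
        by_contra hx
        obtain ⟨x₀, h₀, hx₀⟩ := h.undefined hx
        cases h₀ using ReflTransGen.head_induction_on with
        | refl => exact hx₀ ihs
        | head h₁ h₂ => exact hx₀ (key hts h₁ h₂)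

/-- Lexicographic induction: a computation step of `s` is matched by at least one of `t`, and an
erasing step of `s` decreases its size while leaving `t` in place. -/
theorem Good.erase_star {t : Tm C} (ht : Good Compute t) : ∀ {s : Tm C},
    ReflTransGen Erase t s → Good Step s := by
  have hacc := ht.acc_transGen
  induction hacc with
  | intro t _ ih =>
    intro s hts
    induction hn : s.size using Nat.strong_induction_on generalizing s with
    | _ n ihn =>
      refine .mk (ht.defined_of_erase hts .refl) fun r hr => ?_
      rcases step_iff.1 hr with hr | hr
      · obtain ⟨t₁, h₁, h₂⟩ := ht.star_postpone hts hr
        exact ih t₁ h₁ (ht.star h₁.to_reflTransGen) h₂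
      · exact ihn _ (hn ▸ hr.size_lt) (hts.tail hr) rfl

/-- Perfect normalisation is stable by commutation expansion. -/
theorem Good.of_push {t t' : Tm C} (h : Good Step t') (ht : ReflTransGen Push t t') :
    Good Step t :=
  ((h.mono fun _ _ => Compute.step).of_push_star ht).erase_star .refl

theorem Good.of_subst {t : Tm C} {σ : ℕ → Tm C} (h : Good Step (t.subst σ)) : Good Step t := by
  generalize hs : t.subst σ = s at h
  induction h generalizing t with
  | mk hd _ ih =>
    subst hs
    exact .mk hd.of_subst fun t' ht => ih _ (ht.subst σ) rfl

theorem Good.of_map {f : Tm C → Tm C} (hf : ∀ a b, Step a b → Step (f a) (f b))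
    (hd : ∀ a, (f a).Defined → a.Defined) {t : Tm C} (h : Good Step (f t)) : Good Step t := by
  generalize hs : f t = s at h
  induction h generalizing t with
  | mk hdef _ ih =>
    subst hs
    exact .mk (hd _ hdef) fun t' ht => ih _ (hf _ _ ht) rfl

theorem Good.app_left {t u : Tm C} (h : Good Step (.app t u)) : Good Step t :=
  h.of_map (f := fun x => Tm.app x u) (fun _ _ => .appL u) fun _ h => h.1

theorem Good.app_right {t u : Tm C} (h : Good Step (.app t u)) : Good Step u :=
  h.of_map (f := fun x => Tm.app t x) (fun _ _ => .appR t) fun _ h => h.2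

theorem good_dai : Good Step (.dai : Tm C) := by
  refine .mk trivial fun t' h => ?_
  rcases step_iff.1 h with (h | h)
  · rcases h with ((h | h) | _) <;> cases h
  · rcases h with (h | _); cases h

/-! ### Head reduction -/

theorem step_compat {t t' : Tm C} :
    Step t t' ↔ Compat (fun a b => RootEval a b ∨ RootErase a b ∨ RootPush a b) t t' := by
  constructor <;> refine Compat.mono fun a b h => ?_
  · rw [rootB_iff, rootCom_iff] at h; tauto
  · rw [rootB_iff, rootCom_iff]; tauto

theorem Step.eval {t t' : Tm C} (h : RootEval t t') : Step t t' := step_compat.2 (.root (.inl h))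
theorem Step.erase {t t' : Tm C} (h : RootErase t t') : Step t t' :=
  step_compat.2 (.root (.inr (.inl h)))
theorem Step.push {t t' : Tm C} (h : RootPush t t') : Step t t' :=
  step_compat.2 (.root (.inr (.inr h)))

/-- Deterministic head reduction: an application under a case construct is first commuted. -/
inductive Head : Tm C → Tm C → Prop
  | appLam (p u : Tm C) : Head (.app (.lam p) u) (p.inst u)
  | appDai (u : Tm C) : Head (.app .dai u) .dai
  | appL {a a' : Tm C} (u : Tm C) : Head a a' → Head (.app a u) (.app a' u)
  | caseCons (dom : Finset C) (θ : {c // c ∈ dom} → Tm C) (c : C) (hc : c ∈ dom) :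
      Head (.case dom θ (.con c)) (θ ⟨c, hc⟩)
  | caseDai (dom : Finset C) (θ : {c // c ∈ dom} → Tm C) : Head (.case dom θ .dai) .dai
  | caseApp (dom : Finset C) (θ : {c // c ∈ dom} → Tm C) (t u : Tm C) :
      Head (.case dom θ (.app t u)) (.app (.case dom θ t) u)
  | caseLam (dom : Finset C) (θ : {c // c ∈ dom} → Tm C) (t : Tm C) :
      Head (.case dom θ (.lam t)) (.lam (.case dom (fun c => (θ c).shift) t))
  | caseCase (dom : Finset C) (θ : {c // c ∈ dom} → Tm C) (dom' : Finset C)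
      (φ : {c // c ∈ dom'} → Tm C) (a : Tm C) {b : Tm C} :
      Head (.case dom' φ a) b → Head (.case dom θ (.case dom' φ a)) (.case dom θ b)

theorem Head.step {t t' : Tm C} (h : Head t t') : Step t t' := by
  induction h with
  | appLam p u => exact .eval (.appLam p u)
  | appDai u => exact .erase (.appDai u)
  | appL u _ ih => exact .appL u ih
  | caseCons dom θ c hc => exact .eval (.caseCons dom θ ⟨c, hc⟩)
  | caseDai dom θ => exact .erase (.caseDai dom θ)
  | caseApp dom θ t u => exact .push (.caseApp dom θ t u)
  | caseLam dom θ t => exact .push (.caseLam dom θ t)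
  | caseCase dom θ dom' φ a _ ih => exact .caseArg dom θ ih

theorem Head.not_value {t t' : Tm C} (h : Head t t') : ¬ IsValue t := by
  rintro (hd | ⟨p, rfl⟩)
  · induction hd generalizing t' with
    | con => cases h
    | app u hd ih =>
      cases h with
      | appLam => cases hd
      | appDai => cases hd
      | appL _ h => exact ih h
  · cases h

/-- Closedness excludes variables and definedness excludes match failures in head position, so
nothing but `✠` is stuck without being a value. -/
theorem exists_head {t : Tm C} (hc : t.Closed) (hd : t.Defined) (hv : ¬ IsValue t)
    (hdai : t ≠ .dai) : ∃ h, Head t h := by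
  induction t with
  | var i => exact absurd hc (Nat.not_lt_zero i)
  | lam t => exact absurd (.inr ⟨t, rfl⟩) hv
  | con c => exact absurd (.inl (.con c)) hv
  | dai => exact absurd rfl hdai
  | app a u iha =>
    by_cases ha : IsValue a
    · rcases ha with ha | ⟨p, rfl⟩
      · exact absurd (.inl (.app u ha)) hv
      · exact ⟨_, .appLam p u⟩
    · by_cases hdai : a = .dai
      · subst hdai; exact ⟨_, .appDai u⟩
      · obtain ⟨h, hh⟩ := iha hc.1 hd.1 ha hdai
        exact ⟨_, .appL u hh⟩
  | case dom θ a _ iha =>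
    cases a with
    | var i => exact absurd hc.2 (Nat.not_lt_zero i)
    | lam t => exact ⟨_, .caseLam dom θ t⟩
    | con c => exact ⟨_, .caseCons dom θ c (hd.2.2 c rfl)⟩
    | dai => exact ⟨_, .caseDai dom θ⟩
    | app t u => exact ⟨_, .caseApp dom θ t u⟩
    | case dom' φ a =>
      obtain ⟨h, hh⟩ := iha hc.2 hd.2.1 (by rintro (h | ⟨_, h⟩) <;> cases h) (by simp)
      exact ⟨_, .caseCase dom θ dom' φ a hh⟩

theorem Head.eq_of_root {dom : Finset C} {φ : {c // c ∈ dom} → Tm C} {a b r : Tm C}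
    (h : Head (.case dom φ a) b)
    (hr : RootEval (.case dom φ a) r ∨ RootErase (.case dom φ a) r ∨ RootPush (.case dom φ a) r) :
    b = r := by
  rcases hr with hr | hr | hr <;> cases hr <;> cases h <;> rfl

theorem star_of_branch {R : Tm C → Tm C → Prop} {dom : Finset C}
    {θ θ' : {c // c ∈ dom} → Tm C} {c : {c // c ∈ dom}} (hc : Compat R (θ c) (θ' c))
    (hd : ∀ d, d ≠ c → θ' d = θ d) (d : {c // c ∈ dom}) :
    ReflTransGen (Compat R) (θ d) (θ' d) := by
  by_cases hdc : d = c
  · subst hdc; exact .single hc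
  · rw [hd d hdc]

/-- The head reduct of a term is a principal reduct. -/
theorem Head.diamond {t h : Tm C} (hh : Head t h) : ∀ {r : Tm C}, Step t r →
    ReflTransGen Step h r ∨ ∃ r', Head r r' ∧ ReflTransGen Step h r' := by
  induction hh with
  | appLam p u =>
    intro r hr
    rw [step_compat] at hr
    cases hr with
    | root hr => rcases hr with hr | hr | hr <;> cases hr; exact .inl .refl
    | appL _ hr =>
      cases hr with
      | root hr =>
        rcases hr with hr | hr | hr
        · cases hr
        · cases hr with
          | lamApp => rw [Tm.app_shift_var_inst]; exact .inl .refl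
          | lamDai => exact .inr ⟨_, .appDai u, .refl⟩
        · cases hr
      | lam hr =>
        exact .inr ⟨_, .appLam _ _, .single (Compat.inst_left rootStep_subst (step_compat.2 hr) u)⟩
    | appR _ hr =>
      exact .inr ⟨_, .appLam _ _,
        Compat.star_inst_right rootStep_subst p (.single (step_compat.2 hr))⟩
  | appDai u =>
    intro r hr
    rw [step_compat] at hr
    cases hr with
    | root hr => rcases hr with hr | hr | hr <;> cases hr; exact .inl .refl
    | appL _ hr =>
      cases hr with
      | root hr => rcases hr with hr | hr | hr <;> cases hr
    | appR _ hr => exact .inr ⟨_, .appDai _, .refl⟩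
  | @appL a a' u hh ih =>
    intro r hr
    rw [step_compat] at hr
    cases hr with
    | root hr => rcases hr with hr | hr | hr <;> cases hr <;> cases hh
    | appL _ hr =>
      rcases ih (step_compat.2 hr) with h₁ | ⟨r', h₁, h₂⟩
      · exact .inl (Compat.star_app h₁ .refl)
      · exact .inr ⟨_, .appL u h₁, Compat.star_app h₂ .refl⟩
    | appR _ hr => exact .inr ⟨_, .appL _ hh, .single (.appR _ (step_compat.2 hr))⟩
  | caseCons dom θ c hc =>
    intro r hr
    rw [step_compat] at hr
    cases hr with
    | root hr => rcases hr with hr | hr | hr <;> cases hr; exact .inl .refl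
    | caseArg _ _ hr =>
      cases hr with
      | root hr => rcases hr with hr | hr | hr <;> cases hr
    | caseBranch _ _ θ' _ e he hd =>
      exact .inr ⟨_, .caseCons dom θ' c hc, star_of_branch (step_compat.2 he) hd _⟩
  | caseDai dom θ =>
    intro r hr
    rw [step_compat] at hr
    cases hr with
    | root hr => rcases hr with hr | hr | hr <;> cases hr; exact .inl .refl
    | caseArg _ _ hr =>
      cases hr with
      | root hr => rcases hr with hr | hr | hr <;> cases hr
    | caseBranch _ _ θ' _ e he hd => exact .inr ⟨_, .caseDai dom θ', .refl⟩
  | caseApp dom θ t u =>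
    intro r hr
    rw [step_compat] at hr
    cases hr with
    | root hr => rcases hr with hr | hr | hr <;> cases hr; exact .inl .refl
    | caseArg _ _ hr =>
      cases hr with
      | root hr =>
        rcases hr with hr | hr | hr
        · cases hr with
          | appLam p =>
            -- The step gives `{|θ|}·(p{x ← u})`, which the head reduct `({|θ|}·λx.p)u` reaches by
            -- commuting with `λ` and then contracting β.
            left
            refine .head (.appL u (Step.push (.caseLam dom θ p))) (.single ?_)
            have : Tm.case dom θ (p.inst u) = (Tm.case dom (fun c => (θ c).shift) p).inst u := by
              simp only [Tm.inst_eq, Tm.subst, Tm.shift_subst_scons, Tm.subst_var]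
            rw [this]
            exact .eval (.appLam _ _)
        · cases hr with
          | appDai =>
            exact .inr ⟨_, .caseDai dom θ,
              .head (.appL u (Step.erase (.caseDai dom θ))) (.single (.erase (.appDai u)))⟩
        · cases hr
      | appL _ hr =>
        exact .inr ⟨_, .caseApp _ _ _ _, .single (.appL _ (.caseArg _ _ (step_compat.2 hr)))⟩
      | appR _ hr => exact .inr ⟨_, .caseApp _ _ _ _, .single (.appR _ (step_compat.2 hr))⟩
    | caseBranch _ _ θ' _ e he hd =>
      exact .inr ⟨_, .caseApp dom θ' t u,
        .single (.appL _ (.caseBranch _ _ θ' _ e (step_compat.2 he) hd))⟩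
  | caseLam dom θ t =>
    intro r hr
    rw [step_compat] at hr
    cases hr with
    | root hr => rcases hr with hr | hr | hr <;> cases hr; exact .inl .refl
    | caseArg _ _ hr =>
      cases hr with
      | root hr =>
        rcases hr with hr | hr | hr
        · cases hr
        · cases hr with
          | lamApp =>
            -- The η-step gives `{|θ|}·q`; the head reduct `λx.{|θ|}·(qx)` reaches it by a
            -- commutation followed by η.
            left
            rename_i q
            refine .head (.lam (Step.push (.caseApp _ _ _ _))) (.single ?_)
            exact .erase (.lamApp (.case dom θ q))
          | lamDai =>
            exact .inr ⟨_, .caseDai dom θ,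
              .head (.lam (Step.erase (.caseDai _ _))) (.single (.erase .lamDai))⟩
        · cases hr
      | lam hr =>
        exact .inr ⟨_, .caseLam _ _ _, .single (.lam (.caseArg _ _ (step_compat.2 hr)))⟩
    | caseBranch _ _ θ' _ e he hd =>
      exact .inr ⟨_, .caseLam dom θ' t, .single (.lam (.caseBranch _ _ _ _ e
        (Compat.shift rootStep_subst (step_compat.2 he)) fun d hde => by rw [hd d hde]))⟩
  | @caseCase dom θ dom' φ a b hh ih =>
    intro r hr
    have key : ∀ {dom₁ : Finset C} {φ₁ : {c // c ∈ dom₁} → Tm C} {a₁ : Tm C},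
        Step (.case dom' φ a) (.case dom₁ φ₁ a₁) →
        ReflTransGen Step (.case dom θ b) (.case dom θ (.case dom₁ φ₁ a₁)) ∨
        ∃ r', Head (.case dom θ (.case dom₁ φ₁ a₁)) r' ∧
          ReflTransGen Step (.case dom θ b) r' := by
      intro dom₁ φ₁ a₁ hr
      rcases ih hr with h₁ | ⟨r', h₁, h₂⟩
      · exact .inl (Compat.star_case (fun _ => .refl) h₁)
      · exact .inr ⟨_, .caseCase _ _ _ _ _ h₁, Compat.star_case (fun _ => .refl) h₂⟩
    rw [step_compat] at hr
    cases hr with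
    | root hr => rcases hr with hr | hr | hr <;> cases hr
    | caseArg _ _ hr =>
      cases hr with
      | root hr => rw [← hh.eq_of_root hr]; exact .inl .refl
      | caseArg _ _ hr => exact key (.caseArg _ _ (step_compat.2 hr))
      | caseBranch _ _ φ' _ e he hd => exact key (.caseBranch _ _ φ' _ e (step_compat.2 he) hd)
    | caseBranch _ _ θ' _ e he hd =>
      exact .inr ⟨_, .caseCase _ _ _ _ _ hh,
        .single (.caseBranch _ _ θ' _ e (step_compat.2 he) hd)⟩

/-- Against a commutation step, the diagram closes with commutations only. The relation "commutes
to" is thereby preserved by head reduction, which is the invariant in the proof of CR4 for closures.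
-/
theorem Head.push {t h : Tm C} (hh : Head t h) : ∀ {r : Tm C}, Push t r →
    r = h ∨ ∃ r', Head r r' ∧ ReflTransGen Push h r' := by
  induction hh with
  | appLam p u =>
    intro r hr
    cases hr with
    | root hr => cases hr
    | appL _ hr =>
      cases hr with
      | root hr => cases hr
      | lam hr => exact .inr ⟨_, .appLam _ _, .single (hr.inst_left RootPush.subst u)⟩
    | appR _ hr =>
      exact .inr ⟨_, .appLam _ _, Compat.star_inst_right RootPush.subst p (.single hr)⟩
  | appDai u =>
    intro r hr
    cases hr with
    | root hr => cases hr
    | appL _ hr => cases hr with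
      | root hr => cases hr
    | appR _ hr => exact .inr ⟨_, .appDai _, .refl⟩
  | @appL a a' u hh ih =>
    intro r hr
    cases hr with
    | root hr => cases hr
    | appL _ hr =>
      rcases ih hr with rfl | ⟨r', h₁, h₂⟩
      · exact .inl rfl
      · exact .inr ⟨_, .appL u h₁, Compat.star_app h₂ .refl⟩
    | appR _ hr => exact .inr ⟨_, .appL _ hh, .single (.appR _ hr)⟩
  | caseCons dom θ c hc =>
    intro r hr
    cases hr with
    | root hr => cases hr
    | caseArg _ _ hr => cases hr with
      | root hr => cases hr
    | caseBranch _ _ θ' _ e he hd =>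
      exact .inr ⟨_, .caseCons dom θ' c hc, star_of_branch he hd _⟩
  | caseDai dom θ =>
    intro r hr
    cases hr with
    | root hr => cases hr
    | caseArg _ _ hr => cases hr with
      | root hr => cases hr
    | caseBranch _ _ θ' _ e he hd => exact .inr ⟨_, .caseDai dom θ', .refl⟩
  | caseApp dom θ t u =>
    intro r hr
    cases hr with
    | root hr => cases hr; exact .inl rfl
    | caseArg _ _ hr =>
      cases hr with
      | root hr => cases hr
      | appL _ hr => exact .inr ⟨_, .caseApp _ _ _ _, .single (.appL _ (.caseArg _ _ hr))⟩
      | appR _ hr => exact .inr ⟨_, .caseApp _ _ _ _, .single (.appR _ hr)⟩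
    | caseBranch _ _ θ' _ e he hd =>
      exact .inr ⟨_, .caseApp dom θ' t u, .single (.appL _ (.caseBranch _ _ θ' _ e he hd))⟩
  | caseLam dom θ t =>
    intro r hr
    cases hr with
    | root hr => cases hr; exact .inl rfl
    | caseArg _ _ hr =>
      cases hr with
      | root hr => cases hr
      | lam hr => exact .inr ⟨_, .caseLam _ _ _, .single (.lam (.caseArg _ _ hr))⟩
    | caseBranch _ _ θ' _ e he hd =>
      exact .inr ⟨_, .caseLam dom θ' t, .single (.lam (.caseBranch _ _ _ _ e
        (he.shift RootPush.subst) fun d hde => by rw [hd d hde]))⟩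
  | @caseCase dom θ dom' φ a b hh ih =>
    intro r hr
    have key : ∀ {dom₁ : Finset C} {φ₁ : {c // c ∈ dom₁} → Tm C} {a₁ : Tm C},
        Push (.case dom' φ a) (.case dom₁ φ₁ a₁) →
        .case dom θ (.case dom₁ φ₁ a₁) = Tm.case dom θ b ∨
        ∃ r', Head (.case dom θ (.case dom₁ φ₁ a₁)) r' ∧
          ReflTransGen Push (.case dom θ b) r' := by
      intro dom₁ φ₁ a₁ hr
      rcases ih hr with rfl | ⟨r', h₁, h₂⟩
      · exact .inl rfl
      · exact .inr ⟨_, .caseCase _ _ _ _ _ h₁, Compat.star_case (fun _ => .refl) h₂⟩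
    cases hr with
    | root hr => cases hr
    | caseArg _ _ hr =>
      cases hr with
      | root hr => rw [← hh.eq_of_root (.inr (.inr hr))]; exact .inl rfl
      | caseArg _ _ hr => exact key (.caseArg _ _ hr)
      | caseBranch _ _ φ' _ e he hd => exact key (.caseBranch _ _ φ' _ e he hd)
    | caseBranch _ _ θ' _ e he hd =>
      exact .inr ⟨_, .caseCase _ _ _ _ _ hh, .single (.caseBranch _ _ θ' _ e he hd)⟩

theorem Head.push_star {t h r : Tm C} (hh : Head t h) (hr : ReflTransGen Push t r) :
    ReflTransGen Push h r ∨ ∃ r', Head r r' ∧ ReflTransGen Push h r' := by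
  induction hr using ReflTransGen.head_induction_on generalizing h with
  | refl => exact .inr ⟨h, hh, .refl⟩
  | head h₁ h₂ ih =>
    rcases hh.push h₁ with rfl | ⟨r', h₃, h₄⟩
    · exact .inl h₂
    · rcases ih h₃ with h₅ | ⟨r'', h₅, h₆⟩
      · exact .inl (h₄.trans h₅)
      · exact .inr ⟨r'', h₅, h₄.trans h₆⟩

/-! ### Candidates -/

theorem isDataStructure_app {t u : Tm C} : IsDataStructure (.app t u) ↔ IsDataStructure t :=
  ⟨fun h => by cases h; assumption, .app u⟩

theorem not_isValue_case {dom : Finset C} {θ : {c // c ∈ dom} → Tm C} {t : Tm C} :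
    ¬ IsValue (.case dom θ t) := by
  rintro (h | ⟨_, h⟩) <;> cases h

theorem not_isValue_app_lam {p u : Tm C} : ¬ IsValue (.app (.lam p) u) := by
  rintro (h | ⟨_, h⟩)
  · rw [isDataStructure_app] at h; cases h
  · cases h

theorem not_isValue_dai : ¬ IsValue (.dai : Tm C) := by
  rintro (h | ⟨_, h⟩) <;> cases h

theorem isNeutral_dai : IsNeutral (.dai : Tm C) := ⟨trivial, trivial, not_isValue_dai⟩

theorem not_step_dai {t : Tm C} : ¬ Step .dai t := by
  intro h
  rw [step_compat] at h
  cases h with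
  | root h => rcases h with h | h | h <;> cases h

theorem Tm.Closed.step {t t' : Tm C} (ht : t.Closed) (h : Step t t') : t'.Closed :=
  Tm.ClosedAt.step ht h

/-- The conditions on candidates, except for the one on commutation. -/
structure IsPreCandidate (S : Set (Tm C)) : Prop where
  closed : ∀ t ∈ S, t.Closed
  good : ∀ t ∈ S, Good Step t
  step : ∀ t ∈ S, ∀ t', Step t t' → t' ∈ S
  neutral : ∀ t, IsNeutral t → (∀ t', Step t t' → t' ∈ S) → t ∈ S

theorem IsCandidate.pre {S : Set (Tm C)} (h : IsCandidate S) : IsPreCandidate S :=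
  ⟨h.closed, fun t ht => perfectlyNormalising_iff.1 (h.cr1 t ht), h.cr2, h.cr3⟩

theorem IsCandidate.good {S : Set (Tm C)} (h : IsCandidate S) {t : Tm C} (ht : t ∈ S) :
    Good Step t := h.pre.good t ht

namespace IsPreCandidate

variable {S : Set (Tm C)} (hS : IsPreCandidate S)
include hS

theorem dai_mem : .dai ∈ S := hS.neutral _ isNeutral_dai fun _ h => absurd h not_step_dai

theorem star {t t' : Tm C} (ht : t ∈ S) (h : ReflTransGen Step t t') : t' ∈ S := by
  induction h with
  | refl => exact ht
  | tail _ h ih => exact hS.step _ ih _ h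

/-- Stability by head expansion. -/
theorem of_head {t h : Tm C} (hc : t.Closed) (hg : Good Step t) (hh : Head t h) (hm : h ∈ S) :
    t ∈ S := by
  induction hg generalizing h with
  | mk hd _ ih =>
    refine hS.neutral _ ⟨hc, hd, hh.not_value⟩ fun r hr => ?_
    rcases hh.diamond hr with h₁ | ⟨r', h₁, h₂⟩
    · exact hS.star hm h₁
    · exact ih r hr (hc.step hr) h₁ (hS.star hm h₂)

end IsPreCandidate

/-- A neutral term other than `dai` whose reducts are perfectly normalising has a reduct that
determines to which pre-candidates it belongs. -/
theorem exists_principal {t : Tm C} (hn : IsNeutral t) (hg : ∀ t', Step t t' → Good Step t') :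
    (∀ S : Set (Tm C), IsPreCandidate S → t ∈ S) ∨
      ∃ h, Step t h ∧ ∀ S : Set (Tm C), IsPreCandidate S → h ∈ S → t ∈ S := by
  by_cases hdai : t = .dai
  · subst hdai; exact .inl fun S hS => hS.dai_mem
  · obtain ⟨h, hh⟩ := exists_head hn.1 hn.2.1 hn.2.2 hdai
    exact .inr ⟨h, hh.step, fun S hS hm => hS.of_head hn.1 (.mk hn.2.1 hg) hh hm⟩

/-- Non-empty unions of candidates are candidates. -/
theorem isCandidate_biUnion {ι : Type*} {p : ι → Prop} (hp : ∃ i, p i) {A : ι → Set (Tm C)}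
    (hA : ∀ i, p i → IsCandidate (A i)) : IsCandidate {t | ∃ i, p i ∧ t ∈ A i} where
  closed := by rintro t ⟨i, hi, ht⟩; exact (hA i hi).closed t ht
  cr1 := by rintro t ⟨i, hi, ht⟩; exact (hA i hi).cr1 t ht
  cr2 := by rintro t ⟨i, hi, ht⟩ t' h; exact ⟨i, hi, (hA i hi).cr2 t ht t' h⟩
  cr3 := by
    intro t hn ht
    have hg : ∀ t', Step t t' → Good Step t' := by
      intro t' h
      obtain ⟨i, hi, h⟩ := ht t' h
      exact (hA i hi).good h
    -- The reducts may lie in different members of the family; the member that contains the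
    -- principal reduct also contains the term.
    rcases exists_principal hn hg with h | ⟨h, hs, h'⟩
    · obtain ⟨i, hi⟩ := hp
      exact ⟨i, hi, h _ (hA i hi).pre⟩
    · obtain ⟨i, hi, hm⟩ := ht h hs
      exact ⟨i, hi, h' _ (hA i hi).pre hm⟩
  cr4 := by rintro t t' h ⟨i, hi, ht⟩; exact ⟨i, hi, (hA i hi).cr4 t t' h ht⟩

/-- Non-empty intersections of candidates are candidates. -/
theorem isCandidate_biInter {ι : Type*} {p : ι → Prop} (hp : ∃ i, p i) {A : ι → Set (Tm C)}
    (hA : ∀ i, p i → IsCandidate (A i)) : IsCandidate {t | ∀ i, p i → t ∈ A i} where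
  closed := by intro t ht; obtain ⟨i, hi⟩ := hp; exact (hA i hi).closed t (ht i hi)
  cr1 := by intro t ht; obtain ⟨i, hi⟩ := hp; exact (hA i hi).cr1 t (ht i hi)
  cr2 := fun t ht t' h i hi => (hA i hi).cr2 t (ht i hi) t' h
  cr3 := fun t hn ht i hi => (hA i hi).cr3 t hn fun t' h => ht t' h i hi
  cr4 := fun t t' h ht i hi => (hA i hi).cr4 t t' h (ht i hi)

theorem IsCandidate.union {A B : Set (Tm C)} (hA : IsCandidate A) (hB : IsCandidate B) :
    IsCandidate (A ∪ B) := by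
  have := isCandidate_biUnion (p := fun _ : Bool => True) ⟨true, trivial⟩
    (A := fun b => if b then A else B) (by rintro (_ | _) _ <;> assumption)
  convert this using 1
  ext t; simp [or_comm]

theorem IsCandidate.inter {A B : Set (Tm C)} (hA : IsCandidate A) (hB : IsCandidate B) :
    IsCandidate (A ∩ B) := by
  have := isCandidate_biInter (p := fun _ : Bool => True) ⟨true, trivial⟩
    (A := fun b => if b then A else B) (by rintro (_ | _) _ <;> assumption)
  convert this using 1
  ext t; simp [and_comm]

/-! ### Closure by neutral expansion -/

theorem IsPreCandidate.clo_subset {X S : Set (Tm C)} (hS : IsPreCandidate S) (h : X ⊆ S) :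
    clo X ⊆ S := by
  intro t ht
  induction ht with
  | base hx => exact h hx
  | neutral hn _ ih => exact hS.neutral _ hn ih

theorem clo_mono {X Y : Set (Tm C)} (h : X ⊆ Y) : clo X ⊆ clo Y := by
  intro t ht
  induction ht with
  | base hx => exact .base (h hx)
  | neutral hn _ ih => exact .neutral hn ih

theorem mem_of_mem_clo {X : Set (Tm C)} {t : Tm C} (ht : t ∈ clo X) (hv : IsValue t) : t ∈ X := by
  cases ht with
  | base hx => exact hx
  | neutral hn _ => exact absurd hv hn.2.2

theorem isPreCandidate_clo {X : Set (Tm C)} (hc : ∀ t ∈ X, t.Closed) (hg : ∀ t ∈ X, Good Step t)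
    (hs : ∀ t ∈ X, ∀ t', Step t t' → t' ∈ clo X) : IsPreCandidate (clo X) where
  closed t ht := by
    cases ht with
    | base hx => exact hc t hx
    | neutral hn _ => exact hn.1
  good t ht := by
    induction ht with
    | base hx => exact hg _ hx
    | neutral hn _ ih => exact .mk hn.2.1 ih
  step t ht t' h := by
    cases ht with
    | base hx => exact hs t hx t' h
    | neutral _ ht => exact ht t' h
  neutral t hn h := .neutral hn h

theorem IsDataStructure.push {t t' : Tm C} (ht : IsDataStructure t) (h : Push t t') :
    IsDataStructure t' := by
  induction h with
  | root h => cases h <;> cases ht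
  | appL u _ ih => exact .app u (ih (isDataStructure_app.1 ht))
  | appR t _ _ => exact .app _ (isDataStructure_app.1 ht)
  | _ => cases ht

theorem IsDataStructure.push_star {t t' : Tm C} (ht : IsDataStructure t)
    (h : ReflTransGen Push t t') : IsDataStructure t' := by
  induction h with
  | refl => exact ht
  | tail _ h ih => exact ih.push h

theorem push_star_lam {p t' : Tm C} (h : ReflTransGen Push (.lam p) t') : ∃ p', t' = .lam p' := by
  induction h with
  | refl => exact ⟨p, rfl⟩
  | tail _ h ih =>
    obtain ⟨p', rfl⟩ := ih
    cases h with
    | root h => cases h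
    | lam _ => exact ⟨_, rfl⟩

/-- Since a pre-candidate is stable by head expansion, CR4 need only be checked on data structures,
which is `hp`. For a non-value `t` commuting to `t'`, the head reduct of `t` commutes either to `t'`
or to the head reduct of `t'`; this gives an induction on the reductions of `t'`, then on those of
`t`. -/
theorem isDataCandidate_clo {X : Set (Tm C)} (hX : IsPreCandidate (clo X))
    (hv : ∀ t ∈ X, IsValue t → IsDataStructure t)
    (hp : ∀ t t', IsDataStructure t → Push t t' → t' ∈ X → t ∈ X) : IsDataCandidate (clo X) := by
  have key : ∀ t' ∈ clo X, ∀ t, ReflTransGen Push t t' → t.Closed → t ∈ clo X := by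
    intro t' ht'
    have hacc := (hX.good t' ht').acc
    induction hacc with
    | intro t' _ ih' =>
      intro t ht hc
      have hg : Good Step t := (hX.good t' ht').of_push ht
      have hg' := hg
      induction hg' with
      | @mk t hd hstep ih =>
        by_cases hval : IsValue t
        · rcases hval with hds | ⟨p, rfl⟩
          · refine .base ?_
            have ht'X := mem_of_mem_clo ht' (.inl (hds.push_star ht))
            clear ih hg hc hd hstep
            induction ht using ReflTransGen.head_induction_on with
            | refl => exact ht'X
            | head h₁ _ ih => exact hp _ _ hds h₁ (ih (hds.push_star (.single h₁)))
          -- Commutations keep an abstraction an abstraction, and `clo X` contains none.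
          · obtain ⟨p', rfl⟩ := push_star_lam ht
            cases hv _ (mem_of_mem_clo ht' (.inr ⟨p', rfl⟩)) (.inr ⟨p', rfl⟩)
        · by_cases hdai : t = .dai
          · subst hdai
            exact hX.dai_mem
          · obtain ⟨h, hh⟩ := exists_head hc hd hval hdai
            refine hX.of_head hc hg hh ?_
            rcases hh.push_star ht with h₁ | ⟨r', h₁, h₂⟩
            · exact ih h hh.step h₁ (hc.step hh.step) (hg.step hh.step)
            · exact ih' r' h₁.step (hX.step _ ht' _ h₁.step) h h₂ (hc.step hh.step)
  refine ⟨⟨hX.closed, fun t ht => perfectlyNormalising_iff.2 (hX.good t ht), hX.step, hX.neutral,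
    fun t t' h ht' => ?_⟩, fun t ht hval => hv t (mem_of_mem_clo ht hval) hval⟩
  rw [comStep_iff] at h
  exact key t' ht' t (.single h) (Tm.ClosedAt.of_push (hX.closed t' ht') h)

/-- By `IsPreCandidate.clo_subset` this is the least candidate. It shows that both kinds of
quantification range over a nonempty family. -/
theorem isDataCandidate_clo_empty : IsDataCandidate (clo (∅ : Set (Tm C))) :=
  isDataCandidate_clo (isPreCandidate_clo (by simp) (by simp) (by simp)) (by simp) (by simp)

theorem not_step_con {c : C} {t : Tm C} : ¬ Step (.con c) t := by
  intro h
  rw [step_compat] at h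
  cases h with
  | root h => rcases h with h | h | h <;> cases h

theorem isDataCandidate_clo_con (c : C) : IsDataCandidate (clo ({.con c} : Set (Tm C))) := by
  refine isDataCandidate_clo (isPreCandidate_clo ?_ ?_ ?_) ?_ ?_
  · rintro t rfl; trivial
  · rintro t rfl; exact .mk trivial fun _ h => absurd h not_step_con
  · rintro t rfl t' h; exact absurd h not_step_con
  · rintro t rfl _; exact .con c
  · rintro t t' ht h rfl
    cases h with
    | root h => cases h

theorem IsDataCandidate.not_lam_mem {D : Set (Tm C)} (hD : IsDataCandidate D) {p : Tm C} :
    .lam p ∉ D := by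
  intro h
  cases hD.values _ h (.inr ⟨p, rfl⟩)

/-- No reduct of `d` is an abstraction, so applying `d` never creates a β-redex at the root. -/
theorem good_app_of_mem {D : Set (Tm C)} (hD : IsDataCandidate D) {d u : Tm C} (hd : d ∈ D)
    (hu : Good Step u) : Good Step (.app d u) := by
  have hg := hD.good hd
  induction hg generalizing u with
  | @mk d hdef _ ihd =>
    induction hu with
    | @mk u hudef hu' ihu =>
      refine .mk ⟨hdef, hudef⟩ fun t' h => ?_
      rw [step_compat] at h
      cases h with
      | root h =>
        rcases h with h | h | h
        · cases h; exact absurd hd hD.not_lam_mem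
        · cases h; exact good_dai
        · cases h
      | appL _ h =>
        rw [← step_compat] at h
        exact ihd _ h (hD.cr2 _ hd _ h) (.mk hudef hu')
      | appR _ h => exact ihu _ (step_compat.2 h)

theorem isDataCandidate_clo_app {D T : Set (Tm C)} (hD : IsDataCandidate D) (hT : IsCandidate T) :
    IsDataCandidate (clo (setApp D T)) := by
  refine isDataCandidate_clo (isPreCandidate_clo ?_ ?_ ?_) ?_ ?_
  · rintro _ ⟨d, hd, u, hu, rfl⟩; exact ⟨hD.closed d hd, hT.closed u hu⟩
  · rintro _ ⟨d, hd, u, hu, rfl⟩; exact good_app_of_mem hD hd (hT.good hu)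
  · rintro _ ⟨d, hd, u, hu, rfl⟩ t' h
    rw [step_compat] at h
    cases h with
    | root h =>
      rcases h with h | h | h
      · cases h; exact absurd hd hD.not_lam_mem
      · cases h; exact .neutral isNeutral_dai fun _ h => absurd h not_step_dai
      · cases h
    | appL _ h => exact .base ⟨_, hD.cr2 _ hd _ (step_compat.2 h), u, hu, rfl⟩
    | appR _ h => exact .base ⟨d, hd, _, hT.cr2 _ hu _ (step_compat.2 h), rfl⟩
  · rintro _ ⟨d, hd, u, hu, rfl⟩ (h | ⟨_, h⟩)
    · exact h
    · cases h
  · rintro t _ ht h ⟨d, hd, u, hu, rfl⟩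
    cases h with
    | root h => cases h; cases ht
    | appL _ h => exact ⟨_, hD.cr4 _ _ (comStep_iff.2 h) hd, u, hu, rfl⟩
    | appR _ h => exact ⟨d, hd, _, hT.cr4 _ _ (comStep_iff.2 h) hu, rfl⟩

/-! ### Arrows -/

/-- The arguments need not form a candidate. -/
theorem isCandidate_setArrow {A B : Set (Tm C)} (hne : A.Nonempty) (hc : ∀ u ∈ A, u.Closed)
    (hg : ∀ u ∈ A, Good Step u) (hs : ∀ u ∈ A, ∀ u', Step u u' → u' ∈ A) (hB : IsCandidate B) :
    IsCandidate (setArrow A B) where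
  closed t ht := ht.1
  cr1 t ht := by
    obtain ⟨u, hu⟩ := hne
    exact perfectlyNormalising_iff.2 (hB.good (ht.2 u hu)).app_left
  cr2 t ht t' h := ⟨ht.1.step h, fun u hu => hB.cr2 _ (ht.2 u hu) _ (.appL u h)⟩
  cr3 t hn ht := by
    refine ⟨hn.1, fun u hu => ?_⟩
    have hgu := hg u hu
    induction hgu with
    | @mk u hd _ ih =>
      have hval : ¬ IsValue (.app t u) := by
        rintro (h | ⟨_, h⟩)
        · exact hn.2.2 (.inl (isDataStructure_app.1 h))
        · cases h
      refine hB.cr3 _ ⟨⟨hn.1, hc u hu⟩, ⟨hn.2.1, hd⟩, hval⟩ fun t' h => ?_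
      rw [step_compat] at h
      cases h with
      | root h =>
        rcases h with h | h | h
        · cases h; exact absurd (.inr ⟨_, rfl⟩) hn.2.2
        · cases h; exact hB.pre.dai_mem
        · cases h
      | appL _ h => exact (ht _ (step_compat.2 h)).2 u hu
      | appR _ h => exact ih _ (step_compat.2 h) (hs u hu _ (step_compat.2 h))
  cr4 t t' h ht := by
    have h' := comStep_iff.1 h
    exact ⟨Tm.ClosedAt.of_push ht.1 h', fun u hu => hB.cr4 _ _ (.appL u h) (ht.2 u hu)⟩

theorem IsCandidate.arrow {A B : Set (Tm C)} (hA : IsCandidate A) (hB : IsCandidate B) :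
    IsCandidate (setArrow A B) :=
  isCandidate_setArrow ⟨_, hA.pre.dai_mem⟩ hA.closed hA.pre.good hA.cr2 hB

/-- The candidate of the terms that applied to `u` are in `S`. -/
def spine (u : Tm C) (S : Set (Tm C)) : Set (Tm C) := setArrow {u' | ReflTransGen Step u u'} S

theorem isCandidate_spine {u : Tm C} (hc : u.Closed) (hg : Good Step u) {S : Set (Tm C)}
    (hS : IsCandidate S) : IsCandidate (spine u S) :=
  isCandidate_setArrow ⟨u, .refl⟩ (fun _ h => hc.star h) (fun _ h => hg.star h)
    (fun _ h _ h' => .tail h h') hS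

theorem mem_spine_iff {t u : Tm C} (hc : t.Closed) {S : Set (Tm C)} (hS : IsCandidate S) :
    t ∈ spine u S ↔ .app t u ∈ S :=
  ⟨fun h => h.2 u .refl, fun h => ⟨hc, fun _ hu => hS.pre.star h (Compat.star_app .refl hu)⟩⟩

theorem IsPreCandidate.app_dai_mem {S : Set (Tm C)} (hS : IsPreCandidate S) {v : Tm C}
    (hc : v.Closed) (hg : Good Step v) : .app .dai v ∈ S := by
  induction hg with
  | @mk v hd _ ih =>
    refine hS.neutral _ ⟨⟨trivial, hc⟩, ⟨trivial, hd⟩, (Head.appDai v).not_value⟩ fun t' ht => ?_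
    rw [step_compat] at ht
    cases ht with
    | root ht => rcases ht with ht | ht | ht <;> cases ht; exact hS.dai_mem
    | appL _ ht => exact absurd (step_compat.2 ht) not_step_dai
    | appR _ ht => exact ih _ (step_compat.2 ht) (hc.step (step_compat.2 ht))

/-- Stability by β-expansion. -/
theorem IsPreCandidate.app_lam_mem {S : Set (Tm C)} (hS : IsPreCandidate S) {p v : Tm C}
    (hp : (Tm.lam p).Closed) (hvc : v.Closed) (hvg : Good Step v) (h : p.inst v ∈ S) :
    .app (.lam p) v ∈ S := by
  -- Normalisation of the body comes from that of its instance, and supports the induction on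
  -- reductions of `p`.
  have hpg : Good Step p := by
    have := hS.good _ h
    rw [Tm.inst_eq] at this
    exact this.of_subst
  induction hpg generalizing v with
  | @mk p hpd _ ihp =>
    induction hvg with
    | @mk v hvd hv' ihv =>
      refine hS.neutral _ ⟨⟨hp, hvc⟩, ⟨hpd, hvd⟩, not_isValue_app_lam⟩ fun t' ht => ?_
      rw [step_compat] at ht
      cases ht with
      | root ht => rcases ht with ht | ht | ht <;> cases ht; exact h
      | appL _ ht =>
        cases ht with
        | root ht =>
          rcases ht with ht | ht | ht
          · cases ht
          · cases ht with
            | lamApp => rwa [Tm.app_shift_var_inst] at h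
            | lamDai =>
              exact hS.app_dai_mem hvc (.mk hvd hv')
          · cases ht
        | lam ht =>
          have ht' := step_compat.2 ht
          exact ihp _ ht' (Tm.Closed.step hp (.lam ht')) hvc (.mk hvd hv')
            (hS.step _ h _ (Compat.inst_left rootStep_subst ht' v))
      | appR _ ht =>
        have ht' := step_compat.2 ht
        exact ihv _ ht' (hvc.step ht')
          (hS.star h (Compat.star_inst_right rootStep_subst p (.single ht')))

/-! ### Case constructs in candidates -/

/-- One reduction step in one branch of a case binding. -/
def BranchStep {dom : Finset C} (θ θ' : {c // c ∈ dom} → Tm C) : Prop :=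
  ∃ c, Step (θ c) (θ' c) ∧ ∀ d, d ≠ c → θ' d = θ d

section Case

variable {dom : Finset C} {θ θ' : {c // c ∈ dom} → Tm C}

theorem BranchStep.star_apply (h : ReflTransGen BranchStep θ θ') (c : {c // c ∈ dom}) :
    ReflTransGen Step (θ c) (θ' c) := by
  induction h with
  | refl => exact .refl
  | tail _ h ih =>
    obtain ⟨e, he, hd⟩ := h
    exact ih.trans (star_of_branch he hd c)

/-- A finite product of terminating relations terminates. The induction is on the set of branches
allowed to reduce; a new branch `a` is added by a lexicographic induction, on the reductions of `θ
a` first and then on those of the branches in `s`. -/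
theorem acc_branchStep (hg : ∀ c, Good Step (θ c)) : Acc (fun φ' φ => BranchStep φ φ') θ := by
  classical
  have key : ∀ s : Finset {c // c ∈ dom}, ∀ θ : {c // c ∈ dom} → Tm C,
      (∀ c ∈ s, Acc (fun u t => Step t u) (θ c)) →
      Acc (fun φ' φ : {c // c ∈ dom} → Tm C =>
        ∃ c ∈ s, Step (φ c) (φ' c) ∧ ∀ d, d ≠ c → φ' d = φ d) θ := by
    intro s
    induction s using Finset.induction_on with
    | empty => exact fun θ _ => ⟨_, fun _ ⟨_, h, _⟩ => absurd h (Finset.notMem_empty _)⟩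
    | insert a s ha ih =>
      intro θ hθ
      have hacc := hθ a (Finset.mem_insert_self a s)
      have hθs : ∀ c ∈ s, Acc (fun u t => Step t u) (θ c) :=
        fun c hc => hθ c (Finset.mem_insert_of_mem hc)
      clear hθ
      generalize hx : θ a = x at hacc
      induction hacc generalizing θ with
      | intro x hx' ihx =>
        have hs := ih θ hθs
        induction hs with
        | intro θ _ ihθ =>
          subst hx
          refine ⟨_, fun θ' ⟨c, hc, hstep, hd⟩ => ?_⟩
          rcases Finset.mem_insert.1 hc with rfl | hcs
          · refine ihx _ hstep θ' (fun e he => ?_) rfl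
            rw [hd e (by rintro rfl; exact ha he)]
            exact hθs e he
          · refine ihθ θ' ⟨c, hcs, hstep, hd⟩ (fun e he => ?_) ?_
            · by_cases hec : e = c
              · subst hec; exact (hθs e he).inv hstep
              · rw [hd e hec]; exact hθs e he
            · exact hd a (by rintro rfl; exact ha hcs)
  have := key Finset.univ θ fun c _ => (hg c).acc
  refine Subrelation.accessible (fun {φ' φ} h => ?_) this
  obtain ⟨c, hc⟩ := h
  exact ⟨c, Finset.mem_univ c, hc⟩

variable (hc : ∀ c, (θ c).Closed) (hg : ∀ c, Good Step (θ c))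
include hc hg

/-- If all the reducts of `{|θ'|}·w`, other than by case commutation, are in the candidate `S`
for all the reducts `θ'` of `θ`, then so is `{|θ|}·w`. -/
theorem case_mem_of_reducts {S : Set (Tm C)} (hS : IsPreCandidate S) {w : Tm C} (hw : w.Closed)
    (hwd : w.Defined) (hwc : ∀ c, w = .con c → c ∈ dom)
    (happ : ∀ a b, w ≠ .app a b) (hlam : ∀ p, w ≠ .lam p)
    (hcon : ∀ θ', ReflTransGen BranchStep θ θ' → ∀ c, w = .con c.1 → θ' c ∈ S)
    (h : ∀ θ', ReflTransGen BranchStep θ θ' → ∀ w', Step w w' → .case dom θ' w' ∈ S) :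
    .case dom θ w ∈ S := by
  have hacc := acc_branchStep hg
  induction hacc with
  | intro θ _ ih =>
    refine hS.neutral _ ⟨⟨hc, hw⟩, ⟨fun c => (hg c).defined, hwd, hwc⟩, not_isValue_case⟩
      fun t' ht => ?_
    rw [step_compat] at ht
    cases ht with
    | root ht =>
      rcases ht with ht | ht | ht
      · cases ht with
        | caseCons _ _ c => exact hcon θ .refl c rfl
      · cases ht; exact hS.dai_mem
      · cases ht with
        | caseApp => exact absurd rfl (happ _ _)
        | caseLam => exact absurd rfl (hlam _)
    | caseArg _ _ ht => exact h θ .refl _ (step_compat.2 ht)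
    | caseBranch _ _ θ' _ c ht hd =>
      have hb : BranchStep θ θ' := ⟨c, step_compat.2 ht, hd⟩
      exact ih θ' hb (fun c => (hc c).star (BranchStep.star_apply (.single hb) c))
        (fun c => (hg c).star (BranchStep.star_apply (.single hb) c))
        (fun θ'' h' => hcon θ'' (.head hb h')) (fun θ'' h' => h θ'' (.head hb h'))

theorem case_con_mem {S : Set (Tm C)} (hS : IsPreCandidate S) (c : {c // c ∈ dom})
    (h : θ c ∈ S) : .case dom θ (.con c.1) ∈ S := by
  refine case_mem_of_reducts hc hg hS trivial trivial ?_ (by simp) (by simp) ?_ ?_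
  · rintro _ ⟨⟩; exact c.2
  · intro θ' h' d hd
    have : c = d := Subtype.ext (by injection hd)
    subst this
    exact hS.star h (BranchStep.star_apply h' c)
  · intro θ' _ w' hw; exact absurd hw not_step_con

/-- Case constructs on neutral terms. -/
theorem case_neutral_mem {w : Tm C} (hn : IsNeutral w) (hgw : Good Step w) {S : Set (Tm C)}
    (hS : IsCandidate S)
    (h : ∀ w', Step w w' → ∀ θ', ReflTransGen BranchStep θ θ' → .case dom θ' w' ∈ S) :
    .case dom θ w ∈ S := by
  -- In the application case, the induction hypothesis for the function part is used at the
  -- candidate `spine b S`. A case construct has no root interaction with an outer one, so there all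
  -- reducts come from the argument or from the branches.
  induction w generalizing S with
  | var i => exact absurd hn.1 (Nat.not_lt_zero i)
  | lam t => exact absurd (.inr ⟨t, rfl⟩) hn.2.2
  | con c => exact absurd (.inl (.con c)) hn.2.2
  | dai =>
    exact case_mem_of_reducts hc hg hS.pre trivial trivial (by simp) (by simp) (by simp)
      (by simp) fun _ _ _ hw => absurd hw not_step_dai
  | case dom' φ a =>
    exact case_mem_of_reducts hc hg hS.pre hn.1 hn.2.1 (by simp) (by simp) (by simp)
      (by simp) fun θ' hθ' w' hw => h w' hw θ' hθ'
  | app a b iha =>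
    have hcomm : ∀ (θ' : {c // c ∈ dom} → Tm C) (a' : Tm C),
        ComStep (.case dom θ' (.app a' b)) (.app (.case dom θ' a') b) := fun θ' a' =>
      comStep_iff.2 (.root (.caseApp _ _ _ _))
    refine hS.cr4 _ _ (hcomm θ a) ?_
    by_cases ha : IsValue a
    · rcases ha with ha | ⟨p, rfl⟩
      · exact absurd (.inl (.app b ha)) hn.2.2
      -- A second commutation exposes the β-redex; its contractum is `{|θ|}·(p{x ← b})`, a case on a
      -- reduct of `w`.
      · refine hS.cr4 _ _ (comStep_iff.2 (.appL b (.root (.caseLam _ _ _)))) ?_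
        refine hS.pre.app_lam_mem (p := .case dom (fun c => (θ c).shift) p) ⟨fun c => (hc c).shift, hn.1.1⟩ hn.1.2 hgw.app_right ?_
        have : (Tm.case dom (fun c => (θ c).shift) p).inst b = Tm.case dom θ (p.inst b) := by
          simp only [Tm.inst_eq, Tm.subst, Tm.shift_subst_scons, Tm.subst_var]
        rw [this]
        exact h _ (.eval (.appLam p b)) θ .refl
    · have hsp := isCandidate_spine hn.1.2 hgw.app_right hS
      refine (mem_spine_iff (t := .case dom θ a) ⟨hc, hn.1.1⟩ hS).1
        (iha ⟨hn.1.1, hn.2.1.1, ha⟩ hgw.app_left hsp fun a' haa' θ' hθ' => ?_)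
      refine (mem_spine_iff (t := .case dom θ' a') ⟨fun c => (hc c).star (BranchStep.star_apply hθ' c),
        Tm.Closed.step hn.1.1 haa'⟩ hS).2 ?_
      exact hS.cr2 _ (h _ (.appL b haa') θ' hθ') _ (Push.step (.root (.caseApp _ _ _ _)))

/-- Case constructs need only be checked on generators; neutral expansion is absorbed by
`case_neutral_mem`. All reducts of the binding are quantified over, because branches may reduce
before the argument does. -/
theorem case_clo_mem {X : Set (Tm C)} (hX : IsPreCandidate (clo X)) {S : Set (Tm C)}
    (hS : IsCandidate S)
    (h : ∀ θ', ReflTransGen BranchStep θ θ' → ∀ x ∈ X, .case dom θ' x ∈ S) {w : Tm C}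
    (hw : w ∈ clo X) : ∀ θ', ReflTransGen BranchStep θ θ' → .case dom θ' w ∈ S := by
  induction hw with
  | base hx => exact fun θ' hθ' => h θ' hθ' _ hx
  | neutral hn hw ih =>
    intro θ' hθ'
    refine case_neutral_mem (fun c => (hc c).star (BranchStep.star_apply hθ' c))
      (fun c => (hg c).star (BranchStep.star_apply hθ' c)) hn
      (hX.good _ (.neutral hn hw)) hS fun w' hww' θ'' hθ'' => ih w' hww' θ'' (hθ'.trans hθ'')

end Case

/-! ### Renaming and substitution in the interpretation -/

open Ty

theorem extend_upRen (s : Kind) (A : Set (Tm C)) (ρ : Kind → ℕ → Set (Tm C))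
    (ξ : Kind → ℕ → ℕ) :
    (fun s' i => extend s A ρ s' (Ty.upRen s ξ s' i)) =
      extend s A (fun s' i => ρ s' (ξ s' i)) := by
  funext s' i
  by_cases h : s' = s
  · cases i <;> simp [extend, Ty.upRen, h]
  · simp [extend, Ty.upRen, h]

theorem interp_rename {k : Kind} (T : Ty C k) (ξ : Kind → ℕ → ℕ) (ρ : Kind → ℕ → Set (Tm C)) :
    interp (T.rename ξ) ρ = interp T (fun s i => ρ s (ξ s i)) := by
  induction T generalizing ξ ρ with
  | tvar i => rfl
  | dvar i => rfl
  | con c => rfl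
  | app D T ihD ihT => simp only [Ty.rename, interp, ihD, ihT]
  | arrow T U ihT ihU => simp only [Ty.rename, interp, ihT, ihU]
  | union T U ihT ihU => simp only [Ty.rename, interp, ihT, ihU]
  | inter T U ihT ihU => simp only [Ty.rename, interp, ihT, ihU]
  | all s T ih => simp only [Ty.rename, interp, ih, extend_upRen]
  | ex s T ih => simp only [Ty.rename, interp, ih, extend_upRen]

theorem interp_shift {k : Kind} (s : Kind) (T : Ty C k) (A : Set (Tm C))
    (ρ : Kind → ℕ → Set (Tm C)) : interp (T.shift s) (extend s A ρ) = interp T ρ := by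
  rw [Ty.shift, interp_rename]
  congr 1
  funext s' i
  by_cases h : s' = s <;> simp [extend, h]

theorem interp_toOrd {k : Kind} (T : Ty C k) (ρ : Kind → ℕ → Set (Tm C)) :
    interp T.toOrd ρ = interp T ρ := by
  induction T generalizing ρ with
  | union T U ihT ihU => simp only [toOrd, interp, ihT, ihU]
  | inter T U ihT ihU => simp only [toOrd, interp, ihT, ihU]
  | all s T ih => simp only [toOrd, interp, ih]
  | ex s T ih => simp only [toOrd, interp, ih]
  | _ => rfl

theorem interp_ofData (k : Kind) (D : Ty C .data) (ρ : Kind → ℕ → Set (Tm C)) :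
    interp (ofData k D) ρ = interp D ρ := by
  cases k
  · exact interp_toOrd D ρ
  · rfl

theorem interp_varOf (s : Kind) (i : ℕ) (ρ : Kind → ℕ → Set (Tm C)) :
    interp (varOf s i) ρ = ρ s i := by
  cases s <;> rfl

theorem interp_upSub (s : Kind) (τ : (s : Kind) → ℕ → Ty C s) (A : Set (Tm C))
    (ρ : Kind → ℕ → Set (Tm C)) :
    (fun s' i => interp (Ty.upSub s τ s' i) (extend s A ρ)) =
      extend s A (fun s' i => interp (τ s' i) ρ) := by
  funext s' i
  by_cases h : s' = s
  · subst h
    cases i with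
    | zero => simp [extend, Ty.upSub, interp_varOf]
    | succ i => simp [extend, Ty.upSub, interp_shift]
  · simp [extend, Ty.upSub, h, interp_shift]

theorem interp_subst {k : Kind} (T : Ty C k) (τ : (s : Kind) → ℕ → Ty C s)
    (ρ : Kind → ℕ → Set (Tm C)) :
    interp (T.subst τ) ρ = interp T (fun s i => interp (τ s i) ρ) := by
  induction T generalizing τ ρ with
  | tvar i => rfl
  | dvar i => simp only [Ty.subst, interp, interp_ofData]
  | con c => rfl
  | app D T ihD ihT => simp only [Ty.subst, interp, ihD, ihT]
  | arrow T U ihT ihU => simp only [Ty.subst, interp, ihT, ihU]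
  | union T U ihT ihU => simp only [Ty.subst, interp, ihT, ihU]
  | inter T U ihT ihU => simp only [Ty.subst, interp, ihT, ihU]
  | all s T ih => simp only [Ty.subst, interp, ih, interp_upSub]
  | ex s T ih => simp only [Ty.subst, interp, ih, interp_upSub]

theorem interp_inst {k : Kind} (s : Kind) (T : Ty C k) (A : Ty C s) (ρ : Kind → ℕ → Set (Tm C)) :
    interp (T.inst s A) ρ = interp T (extend s (interp A ρ) ρ) := by
  rw [Ty.inst, interp_subst]
  congr 1
  funext s' i
  cases s <;> cases s' <;> cases i <;> simp [extend, single, interp]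

/-! ### Types are interpreted by candidates -/

theorem IsCandidateOf.isCandidate {k : Kind} {A : Set (Tm C)} (h : IsCandidateOf k A) :
    IsCandidate A := by
  cases k
  · exact h
  · exact h.toIsCandidate

theorem IsDataCandidate.of {k : Kind} {A : Set (Tm C)} (h : IsDataCandidate A) :
    IsCandidateOf k A := by
  cases k
  · exact h.toIsCandidate
  · exact h

theorem exists_isCandidateOf (s : Kind) : ∃ A : Set (Tm C), IsCandidateOf s A :=
  ⟨_, isDataCandidate_clo_empty.of⟩

theorem IsValuation.extend {s : Kind} {A : Set (Tm C)} (hA : IsCandidateOf s A)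
    {ρ : Kind → ℕ → Set (Tm C)} (hρ : IsValuation ρ) : IsValuation (extend s A ρ) := by
  intro s' i
  by_cases h : s' = s
  · subst h
    cases i with
    | zero => simpa [LamCon.extend] using hA
    | succ i => simpa [LamCon.extend] using hρ s' i
  · simpa [LamCon.extend, h] using hρ s' i

/-- Both kinds are treated in one induction: an application type of either kind needs its left part
to be a data candidate. -/
theorem isCandidateOf_interp {k : Kind} (T : Ty C k) {ρ : Kind → ℕ → Set (Tm C)}
    (hρ : IsValuation ρ) : IsCandidateOf k (interp T ρ) := by
  induction T generalizing ρ with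
  | tvar i => exact hρ .ord i
  | dvar i => exact IsDataCandidate.of (hρ .data i)
  | con c => exact (isDataCandidate_clo_con c).of
  | app D T ihD ihT => exact (isDataCandidate_clo_app (ihD hρ) (ihT hρ)).of
  | arrow T U ihT ihU => exact IsCandidate.arrow (ihT hρ) (ihU hρ)
  | @union k T U ihT ihU =>
    have h := (ihT hρ).isCandidate.union (ihU hρ).isCandidate
    cases k
    · exact h
    · exact ⟨h, fun t ht hv => ht.elim (fun ht => (ihT hρ).values t ht hv)
        fun ht => (ihU hρ).values t ht hv⟩
  | @inter k T U ihT ihU =>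
    have h := (ihT hρ).isCandidate.inter (ihU hρ).isCandidate
    cases k
    · exact h
    · exact ⟨h, fun t ht hv => (ihT hρ).values t ht.1 hv⟩
  | @all k s T ih =>
    have h : IsCandidate (interp (.all s T) ρ) :=
      isCandidate_biInter (exists_isCandidateOf s) fun A hA => (ih (hρ.extend hA)).isCandidate
    cases k
    · exact h
    · refine ⟨h, fun t ht hv => ?_⟩
      obtain ⟨A, hA⟩ := exists_isCandidateOf (C := C) s
      exact (ih (hρ.extend hA)).values t (ht A hA) hv
  | @ex k s T ih =>
    have h : IsCandidate (interp (.ex s T) ρ) :=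
      isCandidate_biUnion (exists_isCandidateOf s) fun A hA => (ih (hρ.extend hA)).isCandidate
    cases k
    · exact h
    · refine ⟨h, ?_⟩
      rintro t ⟨A, hA, ht⟩ hv
      exact (ih (hρ.extend hA)).values t ht hv

theorem isCandidate_interp {k : Kind} (T : Ty C k) {ρ : Kind → ℕ → Set (Tm C)}
    (hρ : IsValuation ρ) : IsCandidate (interp T ρ) := (isCandidateOf_interp T hρ).isCandidate

theorem isDataCandidate_interp (D : Ty C .data) {ρ : Kind → ℕ → Set (Tm C)}
    (hρ : IsValuation ρ) : IsDataCandidate (interp D ρ) := isCandidateOf_interp D hρ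

/-! ### Soundness of sub-typing -/

theorem mem_interp_bigInter {k : Kind} {n : ℕ} {T : Fin (n + 1) → Ty C k}
    {ρ : Kind → ℕ → Set (Tm C)} {t : Tm C} :
    t ∈ interp (bigInter n T) ρ ↔ ∀ i, t ∈ interp (T i) ρ := by
  induction n with
  | zero => exact ⟨fun h i => by rwa [Fin.fin_one_eq_zero i], fun h => h 0⟩
  | succ n ih =>
    rw [Fin.forall_fin_succ', ← ih]
    rfl

theorem mem_interp_bigUnion {k : Kind} {n : ℕ} {T : Fin (n + 1) → Ty C k}
    {ρ : Kind → ℕ → Set (Tm C)} {t : Tm C} :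
    t ∈ interp (bigUnion n T) ρ ↔ ∃ i, t ∈ interp (T i) ρ := by
  induction n with
  | zero => exact ⟨fun h => ⟨0, h⟩, fun ⟨i, h⟩ => by rwa [Fin.fin_one_eq_zero i] at h⟩
  | succ n ih =>
    rw [Fin.exists_fin_succ', ← ih]
    rfl

/-- A pre-candidate without values is included in the least one. -/
theorem mem_clo_empty_of_no_value {S : Set (Tm C)} (hS : IsPreCandidate S)
    (hv : ∀ t ∈ S, ¬ IsValue t) : S ⊆ clo ∅ := by
  intro t ht
  have hg := hS.good t ht
  induction hg with
  | @mk t hd _ ih =>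
    exact .neutral ⟨hS.closed t ht, hd, hv t ht⟩ fun t' h => ih t' h (hS.step t ht t' h)

/-- A value of a closure is a generator, here an application, and its two components do not depend
on the index. Terms that are not values are neutral and follow from their reducts. -/
theorem clo_setApp_biInter {ι : Type*} {p : ι → Prop} (hp : ∃ i, p i) {A B : ι → Set (Tm C)}
    (h : ∀ i, p i → IsPreCandidate (clo (setApp (A i) (B i)))) {t : Tm C}
    (ht : ∀ i, p i → t ∈ clo (setApp (A i) (B i))) :
    t ∈ clo (setApp {t | ∀ i, p i → t ∈ A i} {t | ∀ i, p i → t ∈ B i}) := by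
  obtain ⟨i₀, hi₀⟩ := hp
  have hg := (h i₀ hi₀).good t (ht i₀ hi₀)
  induction hg with
  | @mk t hd _ ih =>
    by_cases hv : IsValue t
    · refine .base ?_
      obtain ⟨d, hd, u, hu, rfl⟩ := mem_of_mem_clo (ht i₀ hi₀) hv
      refine ⟨d, fun i hi => ?_, u, fun i hi => ?_, rfl⟩
      · obtain ⟨d', hd', u', hu', heq⟩ := mem_of_mem_clo (ht i hi) hv
        cases heq; exact hd'
      · obtain ⟨d', hd', u', hu', heq⟩ := mem_of_mem_clo (ht i hi) hv
        cases heq; exact hu'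
    · exact .neutral ⟨(h i₀ hi₀).closed _ (ht i₀ hi₀), hd, hv⟩ fun t' hs =>
        ih t' hs fun i hi => (h i hi).step _ (ht i hi) t' hs

/-- The constructor of a data structure. -/
inductive HasHead (c : C) : Tm C → Prop
  | con : HasHead c (.con c)
  | app {t : Tm C} (u : Tm C) : HasHead c t → HasHead c (.app t u)

theorem HasHead.unique {c c' : C} {t : Tm C} (h : HasHead c t) (h' : HasHead c' t) : c = c' := by
  induction h with
  | con => cases h'; rfl
  | app u _ ih => cases h' with
    | app _ h' => exact ih h'

theorem conApp_concat (c : C) (Ts : List (Ty C .ord)) (T : Ty C .ord) :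
    conApp c (Ts ++ [T]) = .app (conApp c Ts) T := by
  simp [conApp]

theorem arrows_concat (Ts : List (Ty C .ord)) (T U : Ty C .ord) :
    arrows (Ts ++ [T]) U = arrows Ts (.arrow T U) := by
  simp [arrows]

/-- Neutral expansion adds no value, so the values are still built from `c` by application. With
`HasHead.unique`, this makes the intersection for two distinct constructors free of values. -/
theorem hasHead_of_mem_conApp {c : C} {Ts : List (Ty C .ord)} {ρ : Kind → ℕ → Set (Tm C)}
    {t : Tm C} (ht : t ∈ interp (conApp c Ts) ρ) (hv : IsDataStructure t) : HasHead c t := by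
  induction Ts using List.reverseRecOn generalizing t with
  | nil =>
    obtain rfl : t = .con c := mem_of_mem_clo (X := {Tm.con c}) ht (.inl hv)
    exact .con
  | append_singleton Ts T ih =>
    rw [conApp_concat] at ht
    obtain ⟨d, hd, u, hu, rfl⟩ := mem_of_mem_clo ht (.inl hv)
    exact .app u (ih hd (isDataStructure_app.1 hv))

/-- Most rules are inclusions between plain sets. Those where an application type must be decomposed
rely on closures having only generators as values, or on the target being stable under neutral
expansion. -/
theorem Sub.sound {T U : Ty C .ord} (h : Sub T U) : ∀ {ρ : Kind → ℕ → Set (Tm C)},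
    IsValuation ρ → interp T ρ ⊆ interp U ρ := by
  have app_pre : ∀ (D : Ty C .data) (T : Ty C .ord) {ρ : Kind → ℕ → Set (Tm C)}, IsValuation ρ →
      IsPreCandidate (clo (setApp (interp D ρ) (interp T ρ))) := fun D T ρ hρ =>
    (isCandidate_interp (.app D T : Ty C .ord) hρ).pre
  induction h with
  | refl T => exact fun _ => subset_rfl
  | trans _ _ ih₁ ih₂ => exact fun hρ => (ih₁ hρ).trans (ih₂ hρ)
  | arrow _ _ ih₁ ih₂ => exact fun hρ t ht => ⟨ht.1, fun u hu => ih₂ hρ (ht.2 u (ih₁ hρ hu))⟩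
  | app _ _ ih₁ ih₂ =>
    intro ρ hρ
    refine clo_mono ?_
    rintro _ ⟨d, hd, u, hu, rfl⟩
    rw [← interp_toOrd] at hd
    have := ih₁ hρ hd
    rw [interp_toOrd] at this
    exact ⟨d, this, u, ih₂ hρ hu, rfl⟩
  | unionIntroL => exact fun _ => Set.subset_union_left
  | unionIntroR => exact fun _ => Set.subset_union_right
  | unionElim _ _ ih₁ ih₂ => exact fun hρ => Set.union_subset (ih₁ hρ) (ih₂ hρ)
  | interIntro _ _ ih₁ ih₂ => exact fun hρ => Set.subset_inter (ih₁ hρ) (ih₂ hρ)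
  | interElimL => exact fun _ => Set.inter_subset_left
  | interElimR => exact fun _ => Set.inter_subset_right
  | allIntro s _ ih =>
    intro ρ hρ t ht A hA
    exact ih (hρ.extend hA) (by rwa [interp_shift])
  | allElim s T A =>
    intro ρ hρ t ht
    rw [interp_inst]
    exact ht _ (isCandidateOf_interp A hρ)
  | exIntro s T A =>
    intro ρ hρ t ht
    rw [interp_inst] at ht
    exact ⟨_, isCandidateOf_interp A hρ, ht⟩
  | exElim s _ ih =>
    rintro ρ hρ t ⟨A, hA, ht⟩
    have := ih (hρ.extend hA) ht
    rwa [interp_shift] at this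
  | data D T =>
    intro ρ hρ t ht
    rw [interp_toOrd] at ht
    exact ⟨(isCandidate_interp D hρ).closed t ht, fun u hu => .base ⟨t, ht, u, hu, rfl⟩⟩
  | constr c₁ c₂ Ts Us hne =>
    intro ρ hρ t ht A hA
    simp only [interp, interp_toOrd] at ht
    -- It suffices to reach the least candidate, which contains every pre-candidate without values.
    refine hA.toIsCandidate.pre.clo_subset (Set.empty_subset A) ?_
    have h₁ := isDataCandidate_interp (conApp c₁ Ts) hρ
    have h₂ := isDataCandidate_interp (conApp c₂ Us) hρ
    refine mem_clo_empty_of_no_value (h₁.toIsCandidate.inter h₂.toIsCandidate).pre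
      (fun v hv hval => ?_) ht
    have hds := h₁.values v hv.1 hval
    exact hne ((hasHead_of_mem_conApp hv.1 hds).unique (hasHead_of_mem_conApp hv.2 hds))
  | appInter n D T =>
    intro ρ hρ t ht
    rw [mem_interp_bigInter] at ht
    have := clo_setApp_biInter (p := fun _ => True) ⟨0, trivial⟩
      (fun i _ => app_pre (D i) (T i) hρ) (fun i _ => ht i)
    refine clo_mono ?_ this
    rintro _ ⟨d, hd, u, hu, rfl⟩
    exact ⟨d, mem_interp_bigInter.2 fun i => hd i trivial, u,
      mem_interp_bigInter.2 fun i => hu i trivial, rfl⟩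
  | appAll s D T =>
    intro ρ hρ t ht
    exact clo_setApp_biInter (exists_isCandidateOf s)
      (fun A hA => app_pre D T (hρ.extend hA)) ht
  | arrowInter n T U =>
    intro ρ hρ t ht
    rw [mem_interp_bigInter] at ht
    refine ⟨(ht 0).1, fun u hu => ?_⟩
    rw [mem_interp_bigInter] at hu ⊢
    exact fun i => (ht i).2 u (hu i)
  | arrowAll s T U =>
    intro ρ hρ t ht
    obtain ⟨A, hA⟩ := exists_isCandidateOf (C := C) s
    exact ⟨(ht A hA).1, fun u hu A hA => (ht A hA).2 u (hu A hA)⟩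
  | arrowUnion n T U =>
    intro ρ hρ t ht
    rw [mem_interp_bigInter] at ht
    refine ⟨(ht 0).1, fun u hu => ?_⟩
    rw [mem_interp_bigUnion] at hu ⊢
    obtain ⟨i, hi⟩ := hu
    exact ⟨i, (ht i).2 u hi⟩
  | arrowEx s T U =>
    intro ρ hρ t ht
    obtain ⟨A, hA⟩ := exists_isCandidateOf (C := C) s
    exact ⟨(ht A hA).1, fun u ⟨A, hA, hu⟩ => ⟨A, hA, (ht A hA).2 u hu⟩⟩
  | unionAppR n D T =>
    intro ρ hρ
    -- The union on the right is a candidate, hence already closed under neutral expansion; only the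
    -- generators `du` remain. The three rules that follow use the same argument.
    refine (isCandidate_interp _ hρ).pre.clo_subset ?_
    rintro _ ⟨d, hd, u, hu, rfl⟩
    rw [mem_interp_bigUnion] at hu ⊢
    obtain ⟨i, hi⟩ := hu
    exact ⟨i, .base ⟨d, hd, u, hi, rfl⟩⟩
  | unionAppL n D T =>
    intro ρ hρ
    refine (isCandidate_interp _ hρ).pre.clo_subset ?_
    rintro _ ⟨d, hd, u, hu, rfl⟩
    rw [mem_interp_bigUnion] at hd ⊢
    obtain ⟨i, hi⟩ := hd
    exact ⟨i, .base ⟨d, hi, u, hu, rfl⟩⟩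
  | exAppR s D T =>
    intro ρ hρ
    refine (isCandidate_interp _ hρ).pre.clo_subset ?_
    rintro _ ⟨d, hd, u, ⟨A, hA, hu⟩, rfl⟩
    exact ⟨A, hA, .base ⟨d, by rwa [interp_shift], u, hu, rfl⟩⟩
  | exAppL s D T =>
    intro ρ hρ
    refine (isCandidate_interp _ hρ).pre.clo_subset ?_
    rintro _ ⟨d, ⟨A, hA, hd⟩, u, hu, rfl⟩
    exact ⟨A, hA, .base ⟨d, hd, u, by rwa [interp_shift], rfl⟩⟩
  | unionAll s T U =>
    intro ρ hρ t ht
    -- The second alternative does not depend on `A`; if it fails, the first must hold for every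
    -- `A`.
    by_cases hU : t ∈ interp U ρ
    · exact .inr hU
    · refine .inl fun A hA => ?_
      rcases ht A hA with h | h
      · exact h
      · rw [interp_shift] at h; exact absurd h hU
  | exInter s T U =>
    rintro ρ hρ t ⟨⟨A, hA, ht⟩, hU⟩
    exact ⟨A, hA, ht, by rwa [interp_shift]⟩

/-! ### Soundness of typing -/

theorem satisfies_map_shift {s : Kind} {A : Set (Tm C)} {σ : ℕ → Tm C} {Γ : Ctx C}
    {ρ : Kind → ℕ → Set (Tm C)} :
    Satisfies σ (Γ.map (shift s)) (extend s A ρ) ↔ Satisfies σ Γ ρ := by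
  constructor
  · intro h i T hi
    have := h i (T.shift s) (by simp [hi])
    rwa [interp_shift] at this
  · intro h i T hi
    rw [List.getElem?_map, Option.map_eq_some_iff] at hi
    obtain ⟨T', hi, rfl⟩ := hi
    rw [interp_shift]
    exact h i T' hi

theorem satisfies_cons {σ : ℕ → Tm C} {T : Ty C .ord} {Γ : Ctx C} {ρ : Kind → ℕ → Set (Tm C)} :
    Satisfies σ (T :: Γ) ρ ↔ σ 0 ∈ interp T ρ ∧ Satisfies (fun i => σ (i + 1)) Γ ρ := by
  constructor
  · exact fun h => ⟨h 0 T rfl, fun i T' hi => h (i + 1) T' (by simpa using hi)⟩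
  · rintro ⟨h₀, h⟩ (_ | i) T' hi
    · obtain rfl : T = T' := by simpa using hi
      exact h₀
    · exact h i T' (by simpa using hi)

theorem satisfies_append_cons {σ : ℕ → Tm C} {T : Ty C .ord} {Γ Δ : Ctx C}
    {ρ : Kind → ℕ → Set (Tm C)} :
    Satisfies σ (Γ ++ T :: Δ) ρ ↔ σ Γ.length ∈ interp T ρ ∧ Satisfies σ Γ ρ ∧
      Satisfies (fun i => σ (i + (Γ.length + 1))) Δ ρ := by
  induction Γ generalizing σ with
  | nil =>
    rw [List.nil_append, satisfies_cons]
    simp [Satisfies]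
  | cons S Γ ih =>
    rw [List.cons_append, satisfies_cons, satisfies_cons, ih]
    simp only [List.length_cons]
    constructor
    · exact fun ⟨h₁, h₂, h₃, h₄⟩ => ⟨h₂, ⟨h₁, h₃⟩, h₄⟩
    · exact fun ⟨h₂, ⟨h₁, h₃⟩, h₄⟩ => ⟨h₁, h₂, h₃, h₄⟩

theorem Tm.ClosedAt.of_subst {t : Tm C} {n m : ℕ} {σ : ℕ → Tm C} (h : (t.subst σ).ClosedAt m)
    (hσ : ∀ i, (σ i).ClosedAt m → i < n) : t.ClosedAt n := by
  induction t generalizing n m σ with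
  | var i => exact hσ i h
  | lam t ih =>
    refine ih (m := m + 1) h ?_
    rintro (_ | i) hi
    · exact Nat.succ_pos _
    · exact Nat.succ_lt_succ (hσ i (Tm.ClosedAt.of_shift hi))
  | app t u iht ihu => exact ⟨iht h.1 hσ, ihu h.2 hσ⟩
  | con c => trivial
  | case dom θ t ihθ iht => exact ⟨fun c => ihθ c (h.1 c) hσ, iht h.2 hσ⟩
  | dai => trivial

theorem Tm.ClosedAt.of_inst {t u : Tm C} (h : (t.inst u).ClosedAt 0) : t.ClosedAt 1 := by
  rw [Tm.inst_eq] at h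
  refine h.of_subst ?_
  rintro (_ | i) hi
  · exact Nat.zero_lt_one
  · exact absurd hi (Nat.not_lt_zero i)

/-- Abstractions in arrows. -/
theorem lam_mem_setArrow {A B : Set (Tm C)} (hA : IsCandidate A) (hB : IsCandidate B) {p : Tm C}
    (h : ∀ u ∈ A, p.inst u ∈ B) : .lam p ∈ setArrow A B := by
  have hc : (Tm.lam p).Closed := Tm.ClosedAt.of_inst (hB.closed _ (h _ hA.pre.dai_mem))
  exact ⟨hc, fun u hu => hB.pre.app_lam_mem hc (hA.closed u hu) (hA.good hu) (h u hu)⟩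

theorem CaseBinding.shift_on_inst (θ : CaseBinding C) (u : Tm C) :
    (θ.shift.on (.var 0)).inst u = θ.on u := by
  simp only [CaseBinding.on, CaseBinding.shift, Tm.inst_eq, Tm.subst, Tm.shift_subst_scons,
    Tm.subst_var, scons]

/-- Induction on the arguments, peeling off the last one: a generator is `du`, and the case moves
onto `d`, where the induction hypothesis is applied with the arrow type `U → T` as target. -/
theorem case_conApp_mem {dom : Finset C} {θ : {c // c ∈ dom} → Tm C} (hc : ∀ c, (θ c).Closed)
    (hg : ∀ c, Good Step (θ c)) {ρ : Kind → ℕ → Set (Tm C)} (hρ : IsValuation ρ) (c : C)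
    (Ts : List (Ty C .ord)) (T : Ty C .ord)
    (h : ∀ θ', ReflTransGen BranchStep θ θ' → .case dom θ' (.con c) ∈ interp (arrows Ts T) ρ)
    {w : Tm C} (hw : w ∈ interp (conApp c Ts) ρ) :
    ∀ θ', ReflTransGen BranchStep θ θ' → .case dom θ' w ∈ interp T ρ := by
  induction Ts using List.reverseRecOn generalizing T w with
  | nil =>
    refine case_clo_mem hc hg (isDataCandidate_clo_con c).toIsCandidate.pre
      (isCandidate_interp T hρ) (fun θ' hθ' x hx => ?_) hw
    obtain rfl : x = .con c := hx
    exact h θ' hθ'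
  | append_singleton Ts U ih =>
    rw [conApp_concat] at hw
    rw [arrows_concat] at h
    refine case_clo_mem hc hg (isDataCandidate_clo_app (isDataCandidate_interp (conApp c Ts) hρ)
      (isCandidate_interp U hρ)).toIsCandidate.pre (isCandidate_interp T hρ) ?_ hw
    rintro θ' hθ' _ ⟨d, hd, u, hu, rfl⟩
    -- CR4 is indispensable here: when `d` is a data structure, `{|θ|}·(du)` commutes to
    -- `({|θ|}·d)u`, and only the latter is known to be in the candidate.
    exact (isCandidate_interp T hρ).cr4 _ _ (comStep_iff.2 (.root (.caseApp _ _ _ _)))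
      ((ih _ h hd θ' hθ').2 u hu)

/-- Without extra arguments, `{|θ|}·t` is the β-reduct of `(λx.{|θ|}·x)t`. With an argument `u`, the
induction hypothesis for `tu` gives `{|θ|}·(tu)`, which reduces by commutation to the required
`({|θ|}·t)u`. -/
theorem CaseBinding.on_mem_arrows {θ : CaseBinding C} {ρ : Kind → ℕ → Set (Tm C)}
    (hρ : IsValuation ρ) {T T' : Ty C .ord} (hθ : θ ∈ interpCB (.arrow T T') ρ)
    (Us : List (Ty C .ord)) {t : Tm C} (ht : t ∈ interp (arrows Us T) ρ) :
    θ.on t ∈ interp (arrows Us T') ρ := by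
  have hθc : ∀ c, (θ.branch c).Closed := fun c => (hθ.1.1 c).of_shift
  induction Us generalizing t with
  | nil =>
    refine (isCandidate_interp T' hρ).cr2 _ (hθ.2 t ht) _ ?_
    have := Step.eval (.appLam (θ.shift.on (.var 0)) t)
    rwa [CaseBinding.shift_on_inst] at this
  | cons U Us ih =>
    refine ⟨⟨hθc, ht.1⟩, fun u hu => ?_⟩
    exact (isCandidate_interp (arrows Us T') hρ).cr2 _ (ih (ht.2 u hu)) _
      (Push.step (.root (.caseApp _ _ _ _)))

/-- The term by which the subject of a typing judgement is interpreted. -/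
def Subject.eval (σ : ℕ → Tm C) : Subject C → Tm C
  | .tm t => t.subst σ
  | .cb θ => .lam ((θ.subst σ).shift.on (.var 0))

/-- Evaluating a case binding to `λx.{|θ|}·x` makes its membership definitionally that of
`interpCB`, so the shared rules are treated once for both subjects. -/
theorem Typing.sound {Γ : Ctx C} {M : Subject C} {T : Ty C .ord} (h : Typing Γ M T) :
    ∀ {ρ : Kind → ℕ → Set (Tm C)}, IsValuation ρ → ∀ {σ : ℕ → Tm C}, Satisfies σ Γ ρ →
      M.eval σ ∈ interp T ρ := by
  induction h with
  | cb θ U T _ c₀ ih =>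
    intro ρ hρ σ hσ
    have hc : ∀ c, ((θ.subst σ).branch c).Closed := fun c =>
      (isCandidate_interp _ hρ).closed _ (ih c hρ hσ)
    have hg : ∀ c, Good Step ((θ.subst σ).branch c) := fun c =>
      (isCandidate_interp _ hρ).good (ih c hρ hσ)
    refine lam_mem_setArrow (isCandidate_interp _ hρ) (isCandidate_interp _ hρ) fun v hv => ?_
    rw [interp_toOrd] at hv
    rw [CaseBinding.shift_on_inst]
    refine case_conApp_mem hc hg hρ c₀.1 (U c₀) (T c₀) (fun θ' hθ' => ?_) hv _ .refl
    have hS := (isCandidate_interp (arrows (U c₀) (T c₀)) hρ).pre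
    exact case_con_mem (fun c => (hc c).star (BranchStep.star_apply hθ' c))
      (fun c => (hg c).star (BranchStep.star_apply hθ' c)) hS c₀
      (hS.star (ih c₀ hρ hσ) (BranchStep.star_apply hθ' c₀))
  | cbBot θ T _ ih =>
    intro ρ hρ σ hσ
    have hc : ∀ c, ((θ.subst σ).branch c).Closed := fun c =>
      (isCandidate_interp _ hρ).closed _ (ih c hρ hσ)
    have hg : ∀ c, Good Step ((θ.subst σ).branch c) := fun c =>
      (isCandidate_interp _ hρ).good (ih c hρ hσ)
    refine lam_mem_setArrow (isCandidate_interp _ hρ) (isCandidate_interp _ hρ) fun v hv => ?_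
    rw [CaseBinding.shift_on_inst]
    intro A hA
    -- The type `∀α.α` is instantiated at the least data candidate, which has no generator: no
    -- branch is ever selected, and the result lies in every candidate.
    exact case_clo_mem hc hg isDataCandidate_clo_empty.toIsCandidate.pre hA (by simp)
      (hv _ isDataCandidate_clo_empty) _ .refl
  | init i hi => exact fun _ _ hσ => hσ i _ hi
  | false Γ T => exact fun hρ _ _ => (isCandidate_interp T hρ).pre.dai_mem
  | constr Γ c => exact fun _ _ _ => .base rfl
  | arrowIntro _ ih =>
    intro ρ hρ σ hσ
    refine lam_mem_setArrow (isCandidate_interp _ hρ) (isCandidate_interp _ hρ) fun u hu => ?_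
    rw [Tm.subst_upSub_inst]
    exact ih hρ (satisfies_cons.2 ⟨hu, hσ⟩)
  | arrowElim _ _ ih₁ ih₂ => exact fun hρ _ hσ => (ih₁ hρ hσ).2 _ (ih₂ hρ hσ)
  | @case Γ t θ U T T' _ _ ih₁ ih₂ =>
    exact fun hρ σ hσ => CaseBinding.on_mem_arrows (θ := θ.subst σ) (T := T) (T' := T') hρ (ih₂ hρ hσ) U (ih₁ hρ hσ)
  | univ s _ ih =>
    exact fun hρ _ hσ A hA => ih (hρ.extend hA) (satisfies_map_shift.2 hσ)
  | inter _ _ ih₁ ih₂ => exact fun hρ _ hσ => ⟨ih₁ hρ hσ, ih₂ hρ hσ⟩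
  | @exist Γ Δ M s T U _ ih =>
    intro ρ hρ σ hσ
    rw [satisfies_append_cons] at hσ
    obtain ⟨⟨A, hA, hT⟩, hΓ, hΔ⟩ := hσ
    -- The witness `A` extends the valuation for the whole premise; neither `U` nor the rest of the
    -- context mentions the new variable.
    rw [← interp_shift s U A ρ]
    refine ih (hρ.extend hA) (satisfies_append_cons.2 ?_)
    rw [List.length_map]
    exact ⟨hT, satisfies_map_shift.2 hΓ, satisfies_map_shift.2 hΔ⟩
  | union _ _ ih₁ ih₂ =>
    intro ρ hρ σ hσ
    rw [satisfies_append_cons] at hσ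
    rcases hσ.1 with hT | hT
    · exact ih₁ hρ (satisfies_append_cons.2 ⟨hT, hσ.2⟩)
    · exact ih₂ hρ (satisfies_append_cons.2 ⟨hT, hσ.2⟩)
  | subs _ hs ih => exact fun hρ _ hσ => hs.sound hρ (ih hρ hσ)

end LamCon

theorem mainTheorem2 {C : Type*} (Γ : LamCon.Ctx C) (T : LamCon.Ty C .ord) :
    (∀ t : LamCon.Tm C, LamCon.Typing Γ (.tm t) T →
      ∀ ρ : LamCon.Kind → ℕ → Set (LamCon.Tm C), LamCon.IsValuation ρ →
        ∀ σ : ℕ → LamCon.Tm C, LamCon.Satisfies σ Γ ρ →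
          t.subst σ ∈ LamCon.interp T ρ) ∧
    (∀ θ : LamCon.CaseBinding C, LamCon.Typing Γ (.cb θ) T →
      ∀ ρ : LamCon.Kind → ℕ → Set (LamCon.Tm C), LamCon.IsValuation ρ →
        ∀ σ : ℕ → LamCon.Tm C, LamCon.Satisfies σ Γ ρ →
          θ.subst σ ∈ LamCon.interpCB T ρ) :=
  ⟨fun _ h _ hρ _ hσ => h.sound hρ hσ, fun _ h _ hρ _ hσ => h.sound hρ hσ⟩
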